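/- Let $\mathbf{Met}$ be the category of extended metric spaces (metrics with values in $[0,\infty]$) and nonexpansive maps; $X\otimes Y$ is $X\times Y$ with the sum of the metrics, and $Y^X=[X,Y]$ is the set of nonexpansive maps $X\to Y$ with the supremum metric. A *$\mathbf{Met}$-category* is a category with an extended metric on each hom-set such that composition $\mathcal C(Y,Z)\otimes\mathcal C(X,Y)\to\mathcal C(X,Z)$ is nonexpansive; a *$\mathbf{Met}$-functor* is a functor that is nonexpansive on hom-sets. A *power* $X^V$ is an object with a nonexpansive family $V\to\mathcal C(X^V,X)$ inducing isometric bijections $\mathcal C(A,X^V)\cong[V,\mathcal C(A,X)]$ for all $A$. *Lawvere theories.* Let $\mathbf{CMet}\subseteq\mathbf{Met}$ be the full subcategory of countable spaces. A *$\mathbf{Met}$-enriched Lawvere theory* $\mathbb T$ is a $\mathbf{Met}$-category with an identity-on-objects (up to renaming, i.e. bijective on objects) $\mathbf{Met}$-functor $F:\mathbf{CMet}^{op}\to\mathbb T$ preserving powers by countable spaces. Write $x^A=F(A)$ and $x=F(*)$ with $*$ the one-point space; for $i\in A$ the projection $\pi_i:x^A\to x$ is the image of the map $*\to A$ picking out $i$.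 $Mod(\mathbb T)$ is the category of $\mathbf{Met}$-functors $M:\mathbb T\to\mathbf{Met}$ preserving powers by countable spaces, and natural transformations, with forgetful functor $M\mapsto M(x)$. *Metric equational theories.* A *metric cardinal* is a countable cardinal with an extended metric. A *metric signature* $\Omega$ is a set of operation symbols, each with a metric cardinal as its arity. Preterms over a set of variables are built inductively from variables and from $f((t_i)_{i\in N})$ with $f$ of arity $N$. Fix a countably infinite set of variables. A *context* $\Gamma$ is a finite or countably infinite list of expressions $y=_\varepsilon z$ with $y,z$ variables and $\varepsilon\in\mathbb R_{\ge0}$. *Judgments* are $\Gamma\vdash t\ ok$ and $\Gamma\vdash s=_\varepsilon t$ with $s,t$ preterms. For a set $S$ of judgments, $\vdash_S$ is the least set of judgments that contains $S$ and is closed under the following rules (where $d(i,j)$ is the distance in the arity $N$ of $f$, and a premise mentioning $d(i,j)$ is only required if $d(i,j)<\infty$): - $\Gamma\vdash y\ ok$ for each variable $y$; $\Gamma\vdash y=_\varepsilon z$ if this equality is in $\Gamma$; - if $\Gamma\vdash t\ ok$ then $\Gamma\vdash t=_0t$; if $\Gamma\vdash s=_\varepsilon t$ then $\Gamma\vdash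 t=_\varepsilon s$; if $\Gamma\vdash s=_\varepsilon t$ and $\Gamma\vdash t=_{\varepsilon'}r$ then $\Gamma\vdash s=_{\varepsilon+\varepsilon'}r$; - if $\varepsilon'<\varepsilon$ and $\Gamma\vdash s=_{\varepsilon'}t$ then $\Gamma\vdash s=_\varepsilon t$; if $\Gamma\vdash s=_{\varepsilon'}t$ for all $\varepsilon'>\varepsilon$ then $\Gamma\vdash s=_\varepsilon t$; - if $\Gamma\vdash s_i=_{d(i,j)}s_j$, $\Gamma\vdash t_i=_{d(i,j)}t_j$ and $\Gamma\vdash s_i=_\varepsilon t_i$ for all $i,j\in N$, then $\Gamma\vdash f((s_i))=_\varepsilon f((t_i))$; - if $\Gamma\vdash t_i\ ok$ and $\Gamma\vdash t_i=_{d(i,j)}t_j$ for all $i,j\in N$, then $\Gamma\vdash f((t_i))\ ok$; - if $\sigma$ assigns a preterm to each variable, $\Gamma\vdash\sigma(y)\ ok$ for all variables $y$, $\Gamma\vdash\sigma(y)=_\delta\sigma(z)$ for all equalities $y=_\delta z$ in a context $\Delta$, and $\Delta\vdash s=_\varepsilon t$, then $\Gamma\vdash s[\sigma]=_\varepsilon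 t[\sigma]$. A set $T$ of judgments is a *metric equational theory* (MET) if $\Gamma\vdash s=_\varepsilon t$ in $T$ implies that $\Gamma\vdash s\ ok$ and $\Gamma\vdash t\ ok$ are in $T$, and $T=\ \vdash_{T^=}$, where $T^=\subseteq T$ is the subset of equational judgments. A *model* of $\Omega$ is a metric space $M$ with nonexpansive maps $M[f]:M^N\to M$ for all $f$ of arity $N$; homomorphisms are nonexpansive maps commuting with the operations. Let $M^\Gamma$ be the set of assignments $\alpha$ of the variables in $M$ with $d(\alpha(y),\alpha(z))\le\varepsilon$ for all $y=_\varepsilon z$ in $\Gamma$. $M$ satisfies $\Gamma\vdash y\ ok$ for each variable $y$, with $M[y](\alpha)=\alpha(y)$; it satisfies $\Gamma\vdash f((t_i))\ ok$ iff it satisfies each $\Gamma\vdash t_i\ ok$ and $\sup_{\alpha\in M^\Gamma}d(M[t_i](\alpha),M[t_j](\alpha))\le d(i,j)$ for all $i,j$, and then $M[f((t_i))](\alpha)=M[f]((M[t_i](\alpha))_i)$; it satisfies $\Gamma\vdash s=_\varepsilon t$ iff it satisfies $\Gamma\vdash s\ ok$ and $\Gamma\vdash t\ ok$ and $\sup_{\alpha\in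 M^\Gamma}d(M[s](\alpha),M[t](\alpha))\le\varepsilon$. $Mod(T)$ is the full subcategory of the models of $\Omega$ that satisfy all judgments in $T$, with its forgetful functor to $\mathbf{Met}$. *The theory $T(\mathbb T)$.* Fix distinct variables $x_0,x_1,\dots$, and for a metric cardinal $C$ let $\Gamma(C)=\{x_i=_{d_C(i,j)}x_j\mid i,j\in C,\ d_C(i,j)<\infty\}$. The signature has one symbol $[f]$ of arity $C$ for each metric cardinal $C$ and each morphism $f:x^C\to x$ of $\mathbb T$. $T(\mathbb T)=\ \vdash_S$, where $S$ consists of the axioms 1. $\Gamma(C)\vdash[f](x_0,x_1,\dots)=_{d(f,f')}[f'](x_0,x_1,\dots)$ for $f,f':x^C\to x$ with $d(f,f')<\infty$; 2. $\Gamma(C)\vdash[\pi_i](x_0,x_1,\dots)=_0x_i$ for $i\in C$; 3. $\Gamma(D)\vdash[f]\big(([g_i](x_0,x_1,\dots))_{i\in C}\big)=_0[f\circ g](x_0,x_1,\dots)$ for $f:x^C\to x$ and $g:x^D\to x^C$, where $g_i=\pi_i\circ g$. **Proposition.** (a) For every $\mathbf{Met}$-enriched Lawvere theory $\mathbb T$,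 $T(\mathbb T)$ is a metric equational theory, and there is an equivalence of categories $E:Mod(\mathbb T)\simeq Mod(T(\mathbb T))$ which commutes with the forgetful functors to $\mathbf{Met}$ and is an isometry on hom-sets, where natural transformations and homomorphisms carry the supremum metrics. (b) Let $R$ be a strong monad on $\mathbf{Met}$, that is, a monad whose underlying functor is a $\mathbf{Met}$-functor. Then there is a metric equational theory $T$ such that the forgetful functor $Mod(T)\to\mathbf{Met}$ has a left adjoint and the monad of this adjunction is isomorphic to $R$, if and only if $R$ is of countable arity, that is, preserves countably filtered ($\aleph_1$-filtered) colimits. -/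

import Mathlib

open CategoryTheory
open scoped ENNReal NNReal

universe u v w v' w'

noncomputable section

namespace MetEq

/-! ### The category of extended metric spaces and nonexpansive maps -/

/-- The internal hom `[X, Y]`: nonexpansive maps with the supremum metric. -/
@[ext]
structure NExp (X : Type v) (Y : Type w) [EMetricSpace X] [EMetricSpace Y] where
  toFun : X → Y
  nonexp : LipschitzWith 1 toFun

instance {X : Type v} {Y : Type w} [EMetricSpace X] [EMetricSpace Y] : FunLike (NExp X Y) X Y where
  coe := NExp.toFun
  coe_injective _ _ h := NExp.ext h

/-- The supremum distance of two functions. -/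
def supDist {X : Type v} {Y : Type w} [EDist Y] (f g : X → Y) : ℝ≥0∞ :=
  ⨆ x, edist (f x) (g x)

lemma supDist_self {X : Type v} {Y : Type w} [EMetricSpace Y] (f : X → Y) : supDist f f = 0 := by
  simp [supDist]

lemma supDist_comm {X : Type v} {Y : Type w} [EMetricSpace Y] (f g : X → Y) :
    supDist f g = supDist g f := by
  simp [supDist, edist_comm]

lemma supDist_triangle {X : Type v} {Y : Type w} [EMetricSpace Y] (f g h : X → Y) :
    supDist f h ≤ supDist f g + supDist g h :=
  iSup_le fun x => (edist_triangle _ (g x) _).trans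
    (add_le_add (le_iSup (fun x => edist (f x) (g x)) x) (le_iSup (fun x => edist (g x) (h x)) x))

lemma eq_of_supDist {X : Type v} {Y : Type w} [EMetricSpace Y] {f g : X → Y}
    (h : supDist f g = 0) : f = g := by
  funext x
  exact eq_of_edist_eq_zero (le_antisymm (h ▸ le_iSup (fun x => edist (f x) (g x)) x) bot_le)

instance {X : Type v} {Y : Type w} [EMetricSpace X] [EMetricSpace Y] :
    EMetricSpace (NExp X Y) where
  edist f g := supDist f.toFun g.toFun
  edist_self f := supDist_self _
  edist_comm f g := supDist_comm _ _
  edist_triangle f g h := supDist_triangle _ _ _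
  eq_of_edist_eq_zero h := NExp.ext (eq_of_supDist h)

/-- Composition of nonexpansive maps (in diagrammatic order). -/
def NExp.comp {X : Type v} {Y : Type w} {Z : Type v'} [EMetricSpace X] [EMetricSpace Y]
    [EMetricSpace Z] (f : NExp X Y) (g : NExp Y Z) : NExp X Z where
  toFun x := g.toFun (f.toFun x)
  nonexp := by simpa [Function.comp_def] using g.nonexp.comp f.nonexp

/-- Extended metric spaces. -/
structure Met : Type (u + 1) where
  carrier : Type u
  [metric : EMetricSpace carrier]

attribute [instance] Met.metric

instance : CoeSort Met.{u} (Type u) := ⟨Met.carrier⟩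

instance : Category.{u} Met.{u} where
  Hom X Y := NExp X Y
  id X := ⟨fun x => x, LipschitzWith.id⟩
  comp f g := f.comp g

/-! ### Categories enriched in `Met` -/

/-- A `Met`-enriched category: a category with an extended metric on each hom-set such that
composition `C(Y, Z) ⊗ C(X, Y) → C(X, Z)` is nonexpansive, where the metric of a tensor product
is the sum of the metrics. -/
class MetCategory (C : Type w) extends Category.{v} C where
  homMetric (X Y : C) : EMetricSpace (X ⟶ Y)
  edist_comp_le {X Y Z : C} (f f' : X ⟶ Y) (g g' : Y ⟶ Z) :
    edist (f ≫ g) (f' ≫ g') ≤ edist f f' + edist g g'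

attribute [reducible, instance] MetCategory.homMetric

instance : MetCategory.{u} Met.{u} where
  homMetric X Y := inferInstanceAs (EMetricSpace (NExp X Y))
  edist_comp_le {X Y Z} f f' g g' := by
    refine iSup_le fun x => (edist_triangle _ (g.toFun (f'.toFun x)) _).trans (add_le_add ?_ ?_)
    · refine (g.nonexp (f.toFun x) (f'.toFun x)).trans ?_
      rw [ENNReal.coe_one, one_mul]
      exact le_iSup (fun x => edist (f.toFun x) (f'.toFun x)) x
    · exact le_iSup (fun y => edist (g.toFun y) (g'.toFun y)) (f'.toFun x)

/-- The opposite of a `Met`-category. -/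
instance {C : Type w} [MetCategory.{v} C] : MetCategory.{v} Cᵒᵖ where
  homMetric X Y := EMetricSpace.induced (fun f : X ⟶ Y => f.unop) Quiver.Hom.unop_inj inferInstance
  edist_comp_le {X Y Z} f f' g g' := by
    change edist (g.unop ≫ f.unop) (g'.unop ≫ f'.unop) ≤ edist f.unop f'.unop + edist g.unop g'.unop
    rw [add_comm]
    exact MetCategory.edist_comp_le _ _ _ _

/-- A full subcategory of a `Met`-category inherits the enrichment. -/
instance instMetCategoryFullSubcategory {C : Type w} [MetCategory.{v} C] (P : ObjectProperty C) :
    MetCategory.{v} P.FullSubcategory where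
  homMetric X Y := EMetricSpace.induced (fun f : X ⟶ Y => f.hom)
    (fun _ _ h => ObjectProperty.hom_ext P h) inferInstance
  edist_comp_le {X Y Z} f f' g g' := by
    change edist (f.hom ≫ g.hom) (f'.hom ≫ g'.hom) ≤ edist f.hom f'.hom + edist g.hom g'.hom
    exact MetCategory.edist_comp_le _ _ _ _

/-- The metric on natural transformations: the supremum of the distances of the components. -/
instance {C : Type w} [Category.{v} C] {D : Type w'} [MetCategory.{v'} D] :
    MetCategory.{max w v'} (C ⥤ D) where
  homMetric F G :=
    { edist := fun α β => ⨆ X, edist (α.app X) (β.app X)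
      edist_self := fun α => by simp
      edist_comm := fun α β => by simp [edist_comm]
      edist_triangle := fun α β γ => iSup_le fun X => (edist_triangle _ (β.app X) _).trans
        (add_le_add (le_iSup (fun X => edist (α.app X) (β.app X)) X)
          (le_iSup (fun X => edist (β.app X) (γ.app X)) X))
      eq_of_edist_eq_zero := fun {α β} h => by
        ext X
        exact eq_of_edist_eq_zero
          (le_antisymm (h ▸ le_iSup (fun X => edist (α.app X) (β.app X)) X) bot_le) }
  edist_comp_le {F G H} α α' β β' :=
    iSup_le fun X => (MetCategory.edist_comp_le (α.app X) (α'.app X) (β.app X) (β'.app X)).trans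
      (add_le_add (le_iSup (fun X => edist (α.app X) (α'.app X)) X)
        (le_iSup (fun X => edist (β.app X) (β'.app X)) X))

/-- An enriched (strong) functor between `Met`-categories: it is nonexpansive on each hom-set. -/
def IsMetFunctor {C : Type w} [MetCategory.{v} C] {D : Type w'} [MetCategory.{v'} D]
    (F : C ⥤ D) : Prop :=
  ∀ ⦃X Y : C⦄ (f g : X ⟶ Y), edist (F.map f) (F.map g) ≤ edist f g

/-- `P`, with the cone `l : V → C(P, X)`, is a power `X ^ V`: the map `h ↦ (v ↦ h ≫ l v)` is an
isomorphism of metric spaces from `C(A, P)` to `[V, C(A, X)]`, for each object `A`. -/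
structure IsPower (V : Type u) [EMetricSpace V] {C : Type w} [MetCategory.{v} C] (X P : C)
    (l : V → (P ⟶ X)) : Prop where
  nonexp : LipschitzWith 1 l
  isometry (A : C) (h h' : A ⟶ P) : edist h h' = supDist (fun a => h ≫ l a) (fun a => h' ≫ l a)
  lift (A : C) (g : V → (A ⟶ X)) : LipschitzWith 1 g → ∃ h : A ⟶ P, ∀ a, h ≫ l a = g a

/-- A functor preserving powers by countable metric spaces (in the universe `u`). -/
def PreservesCountablePowers {C : Type w} [MetCategory.{v} C] {D : Type w'} [MetCategory.{v'} D]
    (F : C ⥤ D) : Prop :=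
  ∀ (V : Type u) [EMetricSpace V] [Countable V] (X P : C) (l : V → (P ⟶ X)),
    IsPower V X P l → IsPower V (F.obj X) (F.obj P) (fun a => F.map (l a))

/-! ### Lawvere theories over `Met` -/

/-- The category of countable extended metric spaces. -/
abbrev CMet : Type (u + 1) := ObjectProperty.FullSubcategory (fun X : Met.{u} => Countable X)

/-- The one-point space. -/
def CMet.point : CMet.{u} := ⟨⟨PUnit⟩, inferInstance⟩

/-- The map from the one-point space that picks out an element. -/
def CMet.const {A : CMet.{u}} (a : A.obj) : CMet.point ⟶ A :=
  ObjectProperty.homMk (P := fun X : Met.{u} => Countable X) (X := CMet.point) (Y := A)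
    (⟨fun _ => a, LipschitzWith.const' a⟩ : NExp PUnit A.obj)

/-- A Lawvere theory over `Met`: a `Met`-category `Obj` with an enriched functor `CMetᵒᵖ ⥤ Obj`
that preserves powers by countable spaces and identifies the objects of `Obj` with those
of `CMetᵒᵖ`. -/
structure LawvereTheory where
  Obj : Type (u + 1)
  [cat : MetCategory.{u} Obj]
  incl : CMet.{u}ᵒᵖ ⥤ Obj
  bijective_obj : Function.Bijective incl.obj
  isMetFunctor : IsMetFunctor incl
  preservesPowers : PreservesCountablePowers.{u} incl

attribute [instance] LawvereTheory.cat

namespace LawvereTheory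

variable (L : LawvereTheory.{u})

/-- The object `x ^ A`. -/
def pow (A : CMet.{u}) : L.Obj := L.incl.obj (Opposite.op A)

/-- The generating object `x`. -/
def x : L.Obj := L.pow CMet.point

/-- The projection `x ^ A ⟶ x` to the component `a`. -/
def proj {A : CMet.{u}} (a : A.obj) : L.pow A ⟶ L.x := L.incl.map (CMet.const a).op

/-- The category of models: enriched functors to `Met` preserving powers by countable spaces, and
their natural transformations. -/
abbrev Model : Type _ :=
  ObjectProperty.FullSubcategory
    (fun M : L.Obj ⥤ Met.{u} => IsMetFunctor M ∧ PreservesCountablePowers.{u} M)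

/-- Natural transformations of models carry the supremum metric. -/
instance : MetCategory.{u + 1} L.Model :=
  instMetCategoryFullSubcategory (C := L.Obj ⥤ Met.{u}) _

/-- The forgetful functor `M ↦ M(x)`. -/
def forget : L.Model ⥤ Met.{u} :=
  ObjectProperty.ι _ ⋙ (evaluation L.Obj Met.{u}).obj L.x

end LawvereTheory

/-! ### Metric equational theories -/

/-- A countable cardinal with an extended metric on the set `{k : ℕ | k < card}`. -/
structure MetricCardinal : Type where
  card : ℕ∞
  metric : EMetricSpace {k : ℕ // (k : ℕ∞) < card}

/-- The underlying set of a metric cardinal. -/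
def MetricCardinal.carrier (C : MetricCardinal) : Type := {k : ℕ // (k : ℕ∞) < C.card}

instance : CoeSort MetricCardinal Type := ⟨MetricCardinal.carrier⟩

instance (C : MetricCardinal) : EMetricSpace C := C.metric

instance (C : MetricCardinal) : Countable C := inferInstanceAs (Countable {k : ℕ // (k : ℕ∞) < C.card})

/-- A metric cardinal as a countable metric space. -/
def MetricCardinal.toCMet (C : MetricCardinal) : CMet.{u} :=
  ⟨⟨ULift.{u} C⟩, inferInstanceAs (Countable (ULift.{u} C))⟩

/-- A metric signature: a set of operation symbols with metric arities. -/
structure Signature where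
  Op : Type u
  arity : Op → MetricCardinal

/-- Preterms over a set of variables. -/
inductive Preterm (Ω : Signature.{u}) (X : Type v) : Type (max u v)
  | var (x : X) : Preterm Ω X
  | op (f : Ω.Op) (t : Ω.arity f → Preterm Ω X) : Preterm Ω X

/-- Simultaneous substitution. -/
def Preterm.subst {Ω : Signature.{u}} {X : Type v} {Y : Type w} (σ : X → Preterm Ω Y) :
    Preterm Ω X → Preterm Ω Y
  | .var x => σ x
  | .op f t => .op f (fun i => (t i).subst σ)

/-- A context over a set of variables: a countable set of quantitative equalities `x =_ε y`,
written as triples `(x, ε, y)`. -/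
structure Context (X : Type v) where
  eqs : Set (X × ℝ≥0 × X)
  countable : eqs.Countable

/-- An assignment satisfies a context if it satisfies all of its equalities. -/
def Context.Sat {X : Type v} (Γ : Context X) {M : Type w} [EMetricSpace M] (α : X → M) : Prop :=
  ∀ x ε y, (x, ε, y) ∈ Γ.eqs → edist (α x) (α y) ≤ (ε : ℝ≥0∞)

/-- Judgments, with the natural numbers as the set of variables: `ok Γ t` is `Γ ⊢ t ok`, and
`eq Γ s ε t` is `Γ ⊢ s =_ε t`. -/
inductive Judgment (Ω : Signature.{u}) : Type u
  | ok (Γ : Context ℕ) (t : Preterm Ω ℕ) : Judgment Ω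
  | eq (Γ : Context ℕ) (s : Preterm Ω ℕ) (ε : ℝ≥0) (t : Preterm Ω ℕ) : Judgment Ω

/-- The least deducibility relation containing `S`. In the rules with a metric arity, infinite
distances impose no condition. -/
inductive Deducible {Ω : Signature.{u}} (S : Set (Judgment Ω)) : Judgment Ω → Prop
  | ax {J : Judgment Ω} : J ∈ S → Deducible S J
  | var (Γ : Context ℕ) (x : ℕ) : Deducible S (.ok Γ (.var x))
  | assum (Γ : Context ℕ) (x : ℕ) (ε : ℝ≥0) (y : ℕ) :
      (x, ε, y) ∈ Γ.eqs → Deducible S (.eq Γ (.var x) ε (.var y))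
  | refl (Γ : Context ℕ) (t : Preterm Ω ℕ) : Deducible S (.ok Γ t) → Deducible S (.eq Γ t 0 t)
  | symm (Γ : Context ℕ) (s t : Preterm Ω ℕ) (ε : ℝ≥0) :
      Deducible S (.eq Γ s ε t) → Deducible S (.eq Γ t ε s)
  | triang (Γ : Context ℕ) (s t r : Preterm Ω ℕ) (ε ε' : ℝ≥0) :
      Deducible S (.eq Γ s ε t) → Deducible S (.eq Γ t ε' r) → Deducible S (.eq Γ s (ε + ε') r)
  | max (Γ : Context ℕ) (s t : Preterm Ω ℕ) (ε ε' : ℝ≥0) :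
      ε' < ε → Deducible S (.eq Γ s ε' t) → Deducible S (.eq Γ s ε t)
  | cont (Γ : Context ℕ) (s t : Preterm Ω ℕ) (ε : ℝ≥0) :
      (∀ ε' : ℝ≥0, ε < ε' → Deducible S (.eq Γ s ε' t)) → Deducible S (.eq Γ s ε t)
  | nexp (Γ : Context ℕ) (f : Ω.Op) (s t : Ω.arity f → Preterm Ω ℕ) (ε : ℝ≥0) :
      (∀ (i j : Ω.arity f) (δ : ℝ≥0), edist i j = δ → Deducible S (.eq Γ (s i) δ (s j))) →
      (∀ (i j : Ω.arity f) (δ : ℝ≥0), edist i j = δ → Deducible S (.eq Γ (t i) δ (t j))) →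
      (∀ i : Ω.arity f, Deducible S (.eq Γ (s i) ε (t i))) →
      Deducible S (.eq Γ (.op f s) ε (.op f t))
  | subst (Γ Δ : Context ℕ) (σ : ℕ → Preterm Ω ℕ) (s t : Preterm Ω ℕ) (ε : ℝ≥0) :
      (∀ x, Deducible S (.ok Γ (σ x))) →
      (∀ x δ y, (x, δ, y) ∈ Δ.eqs → Deducible S (.eq Γ (σ x) δ (σ y))) →
      Deducible S (.eq Δ s ε t) → Deducible S (.eq Γ (s.subst σ) ε (t.subst σ))
  | app (Γ : Context ℕ) (f : Ω.Op) (t : Ω.arity f → Preterm Ω ℕ) :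
      (∀ i, Deducible S (.ok Γ (t i))) →
      (∀ (i j : Ω.arity f) (δ : ℝ≥0), edist i j = δ → Deducible S (.eq Γ (t i) δ (t j))) →
      Deducible S (.ok Γ (.op f t))

/-- The subset of equational judgments. -/
def equational {Ω : Signature.{u}} (T : Set (Judgment Ω)) : Set (Judgment Ω) :=
  {J ∈ T | ∃ Γ s ε t, J = .eq Γ s ε t}

/-- Well-formed collections of judgments. -/
def WellFormed {Ω : Signature.{u}} (T : Set (Judgment Ω)) : Prop :=
  ∀ Γ s ε t, .eq Γ s ε t ∈ T → .ok Γ s ∈ T ∧ .ok Γ t ∈ T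

/-- A metric equational theory: a well-formed collection of judgments that is the least
deducibility relation containing its equational judgments. -/
def IsMET {Ω : Signature.{u}} (T : Set (Judgment Ω)) : Prop :=
  WellFormed T ∧ T = {J | Deducible (equational T) J}

/-- A model of a signature: a metric space `M` with a nonexpansive map `M ^ A → M` for each
operation symbol of arity `A`. -/
structure SigModel (Ω : Signature.{u}) where
  space : Met.{u}
  op (f : Ω.Op) : NExp (NExp (Ω.arity f) space) space

/-- Homomorphisms of models of a signature. -/
@[ext]
structure SigModel.Hom {Ω : Signature.{u}} (M N : SigModel Ω) where
  toNExp : NExp M.space N.space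
  map_op (f : Ω.Op) (m : NExp (Ω.arity f) M.space) : toNExp (M.op f m) = N.op f (m.comp toNExp)

instance {Ω : Signature.{u}} : Category.{u} (SigModel Ω) where
  Hom M N := SigModel.Hom M N
  id M := ⟨⟨fun x => x, LipschitzWith.id⟩, fun _ _ => rfl⟩
  comp {M N K} φ ψ := ⟨φ.toNExp.comp ψ.toNExp, fun f m => by
    change ψ.toNExp (φ.toNExp (M.op f m)) = K.op f ((m.comp φ.toNExp).comp ψ.toNExp)
    rw [φ.map_op, ψ.map_op]⟩

/-- The underlying space of a model of a signature. -/
def SigModel.forget (Ω : Signature.{u}) : SigModel Ω ⥤ Met.{u} where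
  obj M := M.space
  map φ := φ.toNExp

/-- Homomorphisms carry the supremum metric. -/
instance {Ω : Signature.{u}} : MetCategory.{u} (SigModel Ω) where
  homMetric M N := EMetricSpace.induced (fun φ : SigModel.Hom M N => φ.toNExp)
    (fun _ _ h => SigModel.Hom.ext h) inferInstance
  edist_comp_le {M N K} φ φ' ψ ψ' :=
    MetCategory.edist_comp_le (C := Met.{u}) (X := M.space) (Y := N.space) (Z := K.space)
      φ.toNExp φ'.toNExp ψ.toNExp ψ'.toNExp

namespace SigModel

variable {Ω : Signature.{u}} (M : SigModel Ω)

/-- Assignments of the variables in `M` that satisfy the context `Γ`; these are the nonexpansive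
maps to `M` from the metric space presented by `Γ`. -/
def Assignment (Γ : Context ℕ) : Type u := {α : ℕ → M.space // Γ.Sat α}

/-- The interpretation of a preterm `t` in context `Γ`. The value `M[t] : Assignment Γ → M` is
defined exactly if `M` satisfies `Γ ⊢ t ok`: for `t = f (t i)ᵢ` each `M[t i]` has to be
defined, and the supremum distance of `M[t i]` and `M[t j]` has to be at most `d(i, j)`. -/
def interp (Γ : Context ℕ) : Preterm Ω ℕ → Part (M.Assignment Γ → M.space)
  | .var x => Part.some fun α => α.1 x
  | .op f t =>
    ⟨∃ h : ∀ i, (interp Γ (t i)).Dom,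
        ∀ i j, supDist ((interp Γ (t i)).get (h i)) ((interp Γ (t j)).get (h j)) ≤ edist i j,
      fun h α => M.op f
        ⟨fun i => (interp Γ (t i)).get (h.fst i) α, fun i j => by
          rw [ENNReal.coe_one, one_mul]
          exact (le_iSup (fun α => edist ((interp Γ (t i)).get (h.fst i) α)
            ((interp Γ (t j)).get (h.fst j) α)) α).trans (h.snd i j)⟩⟩

/-- Satisfaction of a judgment. -/
def Satisfies : Judgment Ω → Prop
  | .ok Γ t => (M.interp Γ t).Dom
  | .eq Γ s ε t => ∃ (hs : (M.interp Γ s).Dom) (ht : (M.interp Γ t).Dom),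
      supDist ((M.interp Γ s).get hs) ((M.interp Γ t).get ht) ≤ (ε : ℝ≥0∞)

end SigModel

/-- The category of models of a collection of judgments: the full subcategory of the models of the
signature which satisfy all of its judgments. -/
abbrev TheoryModel {Ω : Signature.{u}} (T : Set (Judgment Ω)) : Type (u + 1) :=
  ObjectProperty.FullSubcategory (fun M : SigModel Ω => ∀ J ∈ T, M.Satisfies J)

/-- The forgetful functor to metric spaces. -/
def TheoryModel.forget {Ω : Signature.{u}} (T : Set (Judgment Ω)) : TheoryModel T ⥤ Met.{u} :=
  ObjectProperty.ι _ ⋙ SigModel.forget Ω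

/-! ### The metric equational theory of a Lawvere theory -/

/-- The context `{x_i =_{d(i, j)} x_j | i, j ∈ C, d(i, j) < ∞}`. -/
def MetricCardinal.context (C : MetricCardinal) : Context ℕ where
  eqs := Set.range fun p : {p : C × C // edist p.1 p.2 ≠ ⊤} =>
    (p.1.1.val, (edist p.1.1 p.1.2).toNNReal, p.1.2.val)
  countable := Set.countable_range _

namespace LawvereTheory

variable (L : LawvereTheory.{u})

/-- The signature with a symbol `[f]` of arity `C` for each metric cardinal `C` and each morphism
`f : x ^ C ⟶ x`. -/
def signature : Signature.{u} where
  Op := Σ C : MetricCardinal, (L.pow C.toCMet ⟶ L.x)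
  arity f := f.1

/-- The preterm `[f](x_0, x_1, …)`. -/
def basic {C : MetricCardinal} (f : L.pow C.toCMet ⟶ L.x) : Preterm L.signature ℕ :=
  .op (Ω := L.signature) ⟨C, f⟩ fun i => .var i.val

/-- The axioms. In `comp`, the morphism `g : x ^ D ⟶ x ^ C` is the one which corresponds to the
tuple of the `g i : x ^ D ⟶ x`, so that `g ≫ f` is the composite of `f` with this tuple. -/
inductive Axioms : Judgment L.signature → Prop
  | dist {C : MetricCardinal} (f f' : L.pow C.toCMet ⟶ L.x) (ε : ℝ≥0) (h : edist f f' = ε) :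
      Axioms (.eq C.context (L.basic f) ε (L.basic f'))
  | proj {C : MetricCardinal} (i : C) :
      Axioms (.eq C.context (L.basic (L.proj (A := C.toCMet) (ULift.up i))) 0 (.var i.val))
  | comp {C D : MetricCardinal} (f : L.pow C.toCMet ⟶ L.x)
      (g : C → (L.pow D.toCMet ⟶ L.x)) (g' : L.pow D.toCMet ⟶ L.pow C.toCMet)
      (h : ∀ i : C, g' ≫ L.proj (A := C.toCMet) (ULift.up i) = g i) :
      Axioms (.eq D.context (.op (Ω := L.signature) ⟨C, f⟩ fun i => L.basic (g i)) 0
        (L.basic (g' ≫ f)))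

/-- The metric equational theory generated by the axioms. -/
def theory : Set (Judgment L.signature) := {J | Deducible {J | L.Axioms J} J}

end LawvereTheory

/-! ### Monads -/

/-- A monad on `Met` comes from the metric equational theory `T` if the forgetful functor of `T`
has a left adjoint and the monad is isomorphic to the monad of this adjunction. -/
def ComesFrom (R : Monad Met.{u}) {Ω : Signature.{u}} (T : Set (Judgment Ω)) : Prop :=
  ∃ (F : Met.{u} ⥤ TheoryModel T) (adj : F ⊣ TheoryModel.forget T), Nonempty (adj.toMonad ≅ R)

instance fact_aleph_one_isRegular : Fact (Cardinal.aleph 1 : Cardinal.{u}).IsRegular :=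
  ⟨Cardinal.isRegular_aleph_one⟩

/-- A functor on `Met` of countable arity: it preserves countably filtered
(i.e. `ℵ₁`-filtered) colimits. -/
def CountableArity (F : Met.{u} ⥤ Met.{u}) : Prop :=
  F.IsCardinalAccessible (Cardinal.aleph 1 : Cardinal.{u})

end MetEq

end

/-!
For (a), a model `M` of a Lawvere theory is recovered from the model `M(x)` of its equational
theory: every object is a power `x ^ C`, so `M(x ^ C)` is the space of nonexpansive maps `C → M(x)`.
Conversely a model `N` of the equational theory sends `X` to the space of those families of
operations of `N`, one for each morphism into `x`, that are compatible with composition; such a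
family on `x ^ C` is determined by its values on the projections, hence is a nonexpansive tuple
`C → N`.

For (b), operations have countable arities and the premises of a context are countable in number, so
an `ℵ₁`-filtered colimit of models, computed in metric spaces, is again a model. The forgetful
functor of a metric equational theory therefore preserves `ℵ₁`-filtered colimits, and so does its
monad. Conversely, let the operations of arity `C` be the elements of `R(C)` and the theory all the
judgments valid in every `R`-algebra. If `R` has countable arity then each element of `R(X)`, and
each distance between two of them, comes from a countable subspace of `X`, which makes `R(X)` the
free model on `X`.
-/

noncomputable section

namespace MetEq

open Limits

/-! ### Nonexpansive maps -/

lemma lipschitzWith_one_iff {X : Type v} {Y : Type w} [PseudoEMetricSpace X]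
    [PseudoEMetricSpace Y] {f : X → Y} :
    LipschitzWith 1 f ↔ ∀ x y, edist (f x) (f y) ≤ edist x y := by
  simp [LipschitzWith]

lemma supDist_le_iff {X : Type v} {Y : Type w} [EDist Y] {f g : X → Y} {r : ℝ≥0∞} :
    supDist f g ≤ r ↔ ∀ x, edist (f x) (g x) ≤ r :=
  iSup_le_iff

lemma ennreal_le_of_forall_eq_coe {a b : ℝ≥0∞} (h : ∀ r : ℝ≥0, b = r → a ≤ r) : a ≤ b := by
  induction b with
  | top => exact le_top
  | coe r => exact h r rfl

namespace NExp

variable {X : Type v} {Y : Type w} [EMetricSpace X] [EMetricSpace Y]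

lemma edist_le (f : NExp X Y) (x y : X) : edist (f x) (f y) ≤ edist x y :=
  lipschitzWith_one_iff.1 f.nonexp x y

lemma edist_le_iff {f g : NExp X Y} {r : ℝ≥0∞} : edist f g ≤ r ↔ ∀ x, edist (f x) (g x) ≤ r :=
  supDist_le_iff

lemma edist_apply_le (f g : NExp X Y) (x : X) : edist (f x) (g x) ≤ edist f g :=
  edist_le_iff.1 le_rfl x

@[simp]
lemma mk_apply (f : X → Y) (hf : LipschitzWith 1 f) (x : X) : (⟨f, hf⟩ : NExp X Y) x = f x :=
  rfl

@[simp]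
lemma comp_apply {Z : Type v'} [EMetricSpace Z] (f : NExp X Y) (g : NExp Y Z) (x : X) :
    f.comp g x = g (f x) :=
  rfl

end NExp

instance : ConcreteCategory Met.{u} (fun X Y => NExp X Y) where
  hom f := f
  ofHom f := f

namespace Met

variable {X Y : Met.{u}}

lemma edist_apply_le (f : X ⟶ Y) (x y : X) : edist (f x) (f y) ≤ edist x y :=
  NExp.edist_le f x y

lemma edist_le_iff {f g : X ⟶ Y} {r : ℝ≥0∞} : edist f g ≤ r ↔ ∀ x : X, edist (f x) (g x) ≤ r :=
  NExp.edist_le_iff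

lemma edist_apply_apply_le (f g : X ⟶ Y) (x : X) : edist (f x) (g x) ≤ edist f g :=
  NExp.edist_apply_le f g x

end Met

/-! ### Filtered colimits of metric spaces -/

lemma hasCardinalLT_aleph_one (K : Type v) [Countable K] :
    HasCardinalLT K (Cardinal.aleph 1 : Cardinal.{u}) := by
  rw [HasCardinalLT]
  simp

/-- A cocone of metric spaces is tight if it is jointly surjective and the distance of two
points is attained at some stage. Over `ℵ₁`-filtered diagrams these are the colimit cocones. -/
structure IsTight {J : Type v} [Category.{v'} J] {F : J ⥤ Met.{u}} (c : Cocone F) : Prop where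
  surj (p : c.pt) : ∃ j, ∃ x : F.obj j, c.ι.app j x = p
  dist (j : J) (x y : F.obj j) : ∃ (k : J) (f : j ⟶ k),
    edist (F.map f x) (F.map f y) ≤ edist (c.ι.app j x) (c.ι.app j y)

namespace IsTight

variable {J : Type v} [Category.{v'} J] {F : J ⥤ Met.{u}} {c : Cocone F}

section Cardinal

variable {κ : Cardinal.{w}} [Fact κ.IsRegular] [IsCardinalFiltered J κ] {ι : Type w'}

lemma exists_forall_edist_map_le (hc : IsTight c) (hι : HasCardinalLT ι κ) {j : J}
    (x y : ι → F.obj j) : ∃ (k : J) (f : j ⟶ k), ∀ i,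
      edist (F.map f (x i)) (F.map f (y i)) ≤ edist (c.ι.app j (x i)) (c.ι.app j (y i)) := by
  choose k f hf using fun i => hc.dist j (x i) (y i)
  obtain ⟨m, a, b, hab⟩ := IsCardinalFiltered.wideSpan f hι
  refine ⟨m, b, fun i => ?_⟩
  rw [← hab i, F.map_comp, comp_apply, comp_apply]
  exact (Met.edist_apply_le _ _ _).trans (hf i)

lemma exists_forall_edist_map_map_le (hc : IsTight c) (hι : HasCardinalLT ι κ) {j k : J}
    (x : ι → F.obj j) (y : ι → F.obj k) : ∃ (l : J) (f : j ⟶ l) (g : k ⟶ l), ∀ i,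
      edist (F.map f (x i)) (F.map g (y i)) ≤ edist (c.ι.app j (x i)) (c.ι.app k (y i)) := by
  have := isFiltered_of_isCardinalFiltered J κ
  obtain ⟨l, f, hf⟩ := hc.exists_forall_edist_map_le hι
    (fun i => F.map (IsFiltered.leftToMax j k) (x i))
    (fun i => F.map (IsFiltered.rightToMax j k) (y i))
  refine ⟨l, IsFiltered.leftToMax j k ≫ f, IsFiltered.rightToMax j k ≫ f, fun i => ?_⟩
  simpa only [F.map_comp, comp_apply, Cocone.w_apply] using hf i

lemma exists_isometric_lift (hc : IsTight c) (hι : HasCardinalLT ι κ) (p : ι → c.pt) :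
    ∃ (j : J) (x : ι → F.obj j), (∀ i, c.ι.app j (x i) = p i) ∧
      ∀ i i', edist (x i) (x i') ≤ edist (p i) (p i') := by
  choose j x hx using fun i => hc.surj (p i)
  let y (i : ι) : F.obj (IsCardinalFiltered.max j hι) :=
    F.map (IsCardinalFiltered.toMax j hι i) (x i)
  have hy (i : ι) : c.ι.app _ (y i) = p i := by
    rw [← hx, ← c.w_apply (IsCardinalFiltered.toMax j hι i)]
  obtain ⟨k, f, hf⟩ := hc.exists_forall_edist_map_le
    (hasCardinalLT_prod (Cardinal.IsRegular.aleph0_le Fact.out) hι hι)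
    (fun q : ι × ι => y q.1) (fun q => y q.2)
  refine ⟨k, fun i => F.map f (y i), fun i => by rw [Cocone.w_apply, hy], fun i i' => ?_⟩
  simpa only [hy] using hf (i, i')

end Cardinal

variable [IsFiltered J]

lemma edist_ι_le (hc : IsTight c) (s : Cocone F) {j k : J} (x : F.obj j) (y : F.obj k) :
    edist (s.ι.app j x) (s.ι.app k y) ≤ edist (c.ι.app j x) (c.ι.app k y) := by
  obtain ⟨l, f, h⟩ := hc.dist _ (F.map (IsFiltered.leftToMax j k) x)
    (F.map (IsFiltered.rightToMax j k) y)
  simp only [Cocone.w_apply] at h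
  rw [← s.w_apply (IsFiltered.leftToMax j k), ← s.w_apply (IsFiltered.rightToMax j k),
    ← s.w_apply f, ← s.w_apply f]
  exact (Met.edist_apply_le _ _ _).trans h

/-- The map from the vertex of a tight cocone to the vertex of another cocone. -/
def desc (hc : IsTight c) (s : Cocone F) : c.pt ⟶ s.pt :=
  ConcreteCategory.ofHom
    ⟨fun p => s.ι.app (hc.surj p).choose (hc.surj p).choose_spec.choose, .of_edist_le fun p q => by
      refine (hc.edist_ι_le s _ _).trans ?_
      rw [(hc.surj p).choose_spec.choose_spec, (hc.surj q).choose_spec.choose_spec]⟩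

lemma desc_ι_apply (hc : IsTight c) (s : Cocone F) {j : J} (x : F.obj j) :
    hc.desc s (c.ι.app j x) = s.ι.app j x := by
  refine eq_of_edist_eq_zero (le_bot_iff.1 ((hc.edist_ι_le s _ _).trans ?_))
  rw [(hc.surj _).choose_spec.choose_spec, edist_self]
  exact le_rfl

/-- A tight cocone over a filtered diagram is a colimit. -/
def isColimit (hc : IsTight c) : IsColimit c where
  desc s := hc.desc s
  fac s j := ConcreteCategory.hom_ext _ _ fun x => hc.desc_ι_apply s x
  uniq s m hm := ConcreteCategory.hom_ext _ _ fun p => by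
    obtain ⟨j, x, rfl⟩ := hc.surj p
    rw [hc.desc_ι_apply, ← hm j, comp_apply]

end IsTight

section Construction

variable {J : Type u} [SmallCategory J] (F : J ⥤ Met.{u})

/-- The distance in the colimit of two points of a filtered diagram of metric spaces. -/
def colimDist (a b : Σ j, F.obj j) : ℝ≥0∞ :=
  ⨅ (k : J) (f : a.1 ⟶ k) (g : b.1 ⟶ k), edist (F.map f a.2) (F.map g b.2)

variable {F} in
lemma colimDist_le {a b : Σ j, F.obj j} {k : J} (f : a.1 ⟶ k) (g : b.1 ⟶ k) :
    colimDist F a b ≤ edist (F.map f a.2) (F.map g b.2) :=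
  iInf_le_of_le k (iInf_le_of_le f (iInf_le _ g))

variable {F} in
lemma le_colimDist {a b : Σ j, F.obj j} {r : ℝ≥0∞}
    (h : ∀ (k : J) (f : a.1 ⟶ k) (g : b.1 ⟶ k), r ≤ edist (F.map f a.2) (F.map g b.2)) :
    r ≤ colimDist F a b :=
  le_iInf fun k => le_iInf fun f => le_iInf fun g => h k f g

lemma edist_map_comp_le {j k l : J} (f : j ⟶ k) (g : k ⟶ l) (x y : F.obj j) :
    edist (F.map (f ≫ g) x) (F.map (f ≫ g) y) ≤ edist (F.map f x) (F.map f y) := by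
  rw [F.map_comp, comp_apply, comp_apply]
  exact Met.edist_apply_le _ _ _

variable [IsFiltered J]

lemma colimDist_triangle (a b c : Σ j, F.obj j) :
    colimDist F a c ≤ colimDist F a b + colimDist F b c := by
  conv_rhs => simp only [colimDist, ENNReal.iInf_add, ENNReal.add_iInf]
  refine le_iInf fun k => le_iInf fun f => le_iInf fun g => le_iInf fun k' => le_iInf fun f' =>
    le_iInf fun g' => ?_
  obtain ⟨l, p, q, h⟩ := IsFiltered.span g' f
  calc colimDist F a c
      ≤ edist (F.map (f' ≫ p) a.2) (F.map (g ≫ q) c.2) := colimDist_le _ _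
    _ ≤ edist (F.map (f' ≫ p) a.2) (F.map (g' ≫ p) b.2) +
          edist (F.map (f ≫ q) b.2) (F.map (g ≫ q) c.2) := by
        rw [h]; exact edist_triangle _ _ _
    _ ≤ edist (F.map f' a.2) (F.map g' b.2) + edist (F.map f b.2) (F.map g c.2) := by
        simp only [F.map_comp, comp_apply]
        gcongr <;> exact Met.edist_apply_le _ _ _

/-- The disjoint union of the spaces of a filtered diagram, with the pseudometric whose metric
quotient is the colimit. -/
def ColimPoint : Type u := Σ j, F.obj j

instance : PseudoEMetricSpace (ColimPoint F) where
  edist := colimDist F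
  edist_self a := le_bot_iff.1 ((colimDist_le (𝟙 a.1) (𝟙 a.1)).trans (edist_self _).le)
  edist_comm a b := le_antisymm
    (le_colimDist fun _ f g => (colimDist_le g f).trans (edist_comm _ _).le)
    (le_colimDist fun _ f g => (colimDist_le g f).trans (edist_comm _ _).le)
  edist_triangle := colimDist_triangle F

variable {F} in
/-- The class in the colimit of a point of the diagram. -/
def colimMk {j : J} (x : F.obj j) : SeparationQuotient (ColimPoint F) :=
  SeparationQuotient.mk (⟨j, x⟩ : ColimPoint F)

variable {F} in
lemma edist_colimMk {j k : J} (x : F.obj j) (y : F.obj k) :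
    edist (colimMk x) (colimMk y) = colimDist F ⟨j, x⟩ ⟨k, y⟩ :=
  SeparationQuotient.edist_mk (X := ColimPoint F) ⟨j, x⟩ ⟨k, y⟩

/-- The colimit cocone of a filtered diagram of metric spaces. -/
def colimCocone : Cocone F where
  pt := ⟨SeparationQuotient (ColimPoint F)⟩
  ι :=
    { app j := ConcreteCategory.ofHom (C := Met) ⟨colimMk, .of_edist_le fun x y => by
        rw [edist_colimMk]
        exact (colimDist_le (𝟙 j) (𝟙 j)).trans_eq (by simp)⟩
      naturality j k f := ConcreteCategory.hom_ext _ _ fun x =>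
        eq_of_edist_eq_zero (le_bot_iff.1 ((edist_colimMk _ _).trans_le
          ((colimDist_le (𝟙 k) f).trans_eq (by rw [F.map_id, id_apply]; exact edist_self _)))) }

end Construction

section CountablyFiltered

variable {J : Type u} [SmallCategory J] [IsCardinalFiltered J (Cardinal.aleph 1 : Cardinal.{u})]

variable (J) in
instance : IsFiltered J :=
  isFiltered_of_isCardinalFiltered J (Cardinal.aleph 1 : Cardinal.{u})

lemma exists_iInf_edist_map_attained (F : J ⥤ Met.{u}) {j : J} (x y : F.obj j) :
    ∃ (k : J) (f : j ⟶ k), ∀ (l : J) (g : j ⟶ l),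
      edist (F.map f x) (F.map f y) ≤ edist (F.map g x) (F.map g y) := by
  let S : Set ℝ≥0∞ := Set.range fun p : Σ k, j ⟶ k => edist (F.map p.2 x) (F.map p.2 y)
  obtain ⟨r, -, hr, hrS⟩ := exists_seq_tendsto_sInf (S := S) ⟨_, ⟨j, 𝟙 j⟩, rfl⟩
    (OrderBot.bddBelow S)
  choose p hp using hrS
  obtain ⟨k, a, f, hf⟩ :=
    IsCardinalFiltered.wideSpan (fun n => (p n).2) (hasCardinalLT_aleph_one.{u} ℕ)
  have hfS : edist (F.map f x) (F.map f y) ≤ sInf S := ge_of_tendsto' hr fun n => by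
    rw [← hp n, ← hf n]
    exact edist_map_comp_le F _ _ _ _
  exact ⟨k, f, fun l g => hfS.trans (sInf_le ⟨⟨l, g⟩, rfl⟩)⟩

lemma isTight_colimCocone (F : J ⥤ Met.{u}) : IsTight (colimCocone F) := by
  refine ⟨fun p => ?_, fun j x y => ?_⟩
  · obtain ⟨⟨j, x⟩, rfl⟩ := SeparationQuotient.surjective_mk p
    exact ⟨j, x, rfl⟩
  · obtain ⟨k, f, hf⟩ := exists_iInf_edist_map_attained F x y
    refine ⟨k, f, le_trans (le_colimDist fun l (g g' : j ⟶ l) => ?_) (edist_colimMk x y).ge⟩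
    let h := IsFiltered.coeqHom g g'
    calc edist (F.map f x) (F.map f y)
        ≤ edist (F.map (g ≫ h) x) (F.map (g ≫ h) y) := hf _ _
      _ = edist (F.map h (F.map g x)) (F.map h (F.map g' y)) := by
          rw [← comp_apply, ← comp_apply, ← F.map_comp, ← F.map_comp,
            ← IsFiltered.coeq_condition g g']
      _ ≤ edist (F.map g x) (F.map g' y) := Met.edist_apply_le _ _ _

lemma isTight_of_isColimit {F : J ⥤ Met.{u}} {c : Cocone F} (hc : IsColimit c) : IsTight c := by
  have htight := isTight_colimCocone F
  let e := hc.coconePointUniqueUpToIso htight.isColimit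
  have e_ι {j : J} (x : F.obj j) : e.hom (c.ι.app j x) = (colimCocone F).ι.app j x :=
    ConcreteCategory.congr_hom (hc.comp_coconePointUniqueUpToIso_hom htight.isColimit j) x
  have inv_e (p : c.pt) : e.inv (e.hom p) = p := ConcreteCategory.congr_hom e.hom_inv_id p
  refine ⟨fun p => ?_, fun j x y => ?_⟩
  · obtain ⟨j, x, hx⟩ := htight.surj (e.hom p)
    exact ⟨j, x, by rw [← inv_e p, ← hx, ← e_ι, inv_e]⟩
  · obtain ⟨k, f, h⟩ := htight.dist j x y
    refine ⟨k, f, h.trans ?_⟩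
    rw [← e_ι, ← e_ι]
    exact Met.edist_apply_le _ _ _

end CountablyFiltered

/-! ### Satisfaction and soundness -/

namespace SigModel

variable {Ω : Signature.{u}} (M : SigModel Ω) {Γ Δ : Context ℕ} {s t : Preterm Ω ℕ} {ε : ℝ≥0}

lemma mem_interp_var {x : ℕ} {v : M.Assignment Γ → M.space} :
    v ∈ M.interp Γ (.var x) ↔ v = fun α => α.1 x :=
  Part.mem_some_iff

lemma mem_interp_op {f : Ω.Op} {t : Ω.arity f → Preterm Ω ℕ} {w : M.Assignment Γ → M.space} :
    w ∈ M.interp Γ (.op f t) ↔ ∃ (v : Ω.arity f → M.Assignment Γ → M.space)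
      (_ : ∀ i, v i ∈ M.interp Γ (t i)) (h : ∀ α, LipschitzWith 1 fun i => v i α),
      w = fun α => M.op f ⟨fun i => v i α, h α⟩ := by
  constructor
  · rintro ⟨⟨hdom, hdist⟩, rfl⟩
    exact ⟨fun i => (M.interp Γ (t i)).get (hdom i), fun i => Part.get_mem _,
      fun α => .of_edist_le fun i j => supDist_le_iff.1 (hdist i j) α, rfl⟩
  · rintro ⟨v, hv, h, rfl⟩
    choose hdom hget using hv
    obtain rfl : (fun i => (M.interp Γ (t i)).get (hdom i)) = v := funext hget
    exact ⟨⟨hdom, fun i j => supDist_le_iff.2 fun α => lipschitzWith_one_iff.1 (h α) i j⟩, rfl⟩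

variable {M}

lemma satisfies_ok_iff : M.Satisfies (.ok Γ t) ↔ ∃ v, v ∈ M.interp Γ t :=
  Part.dom_iff_mem

lemma Satisfies.ok_left (h : M.Satisfies (.eq Γ s ε t)) : M.Satisfies (.ok Γ s) :=
  h.fst

lemma Satisfies.ok_right (h : M.Satisfies (.eq Γ s ε t)) : M.Satisfies (.ok Γ t) :=
  h.snd.fst

lemma satisfies_eq_iff_of_mem {v w : M.Assignment Γ → M.space} (hv : v ∈ M.interp Γ s)
    (hw : w ∈ M.interp Γ t) : M.Satisfies (.eq Γ s ε t) ↔ ∀ α, edist (v α) (w α) ≤ ε := by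
  obtain ⟨hs, rfl⟩ := hv
  obtain ⟨ht, rfl⟩ := hw
  exact ⟨fun ⟨_, _, h⟩ => supDist_le_iff.1 h, fun h => ⟨hs, ht, supDist_le_iff.2 h⟩⟩

lemma Satisfies.triang {r : Preterm Ω ℕ} {ε' : ℝ≥0} (hst : M.Satisfies (.eq Γ s ε t))
    (htr : M.Satisfies (.eq Γ t ε' r)) : M.Satisfies (.eq Γ s (ε + ε') r) := by
  obtain ⟨u, hu⟩ := satisfies_ok_iff.1 hst.ok_left
  obtain ⟨v, hv⟩ := satisfies_ok_iff.1 hst.ok_right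
  obtain ⟨w, hw⟩ := satisfies_ok_iff.1 htr.ok_right
  rw [satisfies_eq_iff_of_mem hu hv] at hst
  rw [satisfies_eq_iff_of_mem hv hw] at htr
  refine (satisfies_eq_iff_of_mem hu hw).2 fun α => ?_
  calc edist (u α) (w α) ≤ edist (u α) (v α) + edist (v α) (w α) := edist_triangle _ _ _
    _ ≤ ε + ε' := add_le_add (hst α) (htr α)
    _ = (ε + ε' : ℝ≥0) := (ENNReal.coe_add _ _).symm

lemma satisfies_of_forall_lt (h : ∀ ε', ε < ε' → M.Satisfies (.eq Γ s ε' t)) :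
    M.Satisfies (.eq Γ s ε t) := by
  have hok := h (ε + 1) (lt_add_one ε)
  obtain ⟨v, hv⟩ := satisfies_ok_iff.1 hok.ok_left
  obtain ⟨w, hw⟩ := satisfies_ok_iff.1 hok.ok_right
  simp only [satisfies_eq_iff_of_mem hv hw] at h ⊢
  exact fun α => ENNReal.le_of_forall_pos_le_add fun δ hδ _ => by
    simpa using h (ε + δ) (lt_add_of_pos_right ε hδ) α

lemma lipschitzWith_of_satisfies {ι : Type w} [EMetricSpace ι] {t : ι → Preterm Ω ℕ}
    {v : ι → M.Assignment Γ → M.space} (hv : ∀ i, v i ∈ M.interp Γ (t i))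
    (h : ∀ (i j : ι) (δ : ℝ≥0), edist i j = δ → M.Satisfies (.eq Γ (t i) δ (t j)))
    (α : M.Assignment Γ) : LipschitzWith 1 fun i => v i α :=
  .of_edist_le fun i j => ennreal_le_of_forall_eq_coe fun δ hδ =>
    (satisfies_eq_iff_of_mem (hv i) (hv j)).1 (h i j δ hδ) α

lemma satisfies_ok_op {f : Ω.Op} {t : Ω.arity f → Preterm Ω ℕ}
    (hok : ∀ i, M.Satisfies (.ok Γ (t i)))
    (h : ∀ i j (δ : ℝ≥0), edist i j = δ → M.Satisfies (.eq Γ (t i) δ (t j))) :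
    M.Satisfies (.ok Γ (.op f t)) := by
  choose v hv using fun i => satisfies_ok_iff.1 (hok i)
  exact satisfies_ok_iff.2
    ⟨_, M.mem_interp_op.2 ⟨v, hv, lipschitzWith_of_satisfies hv h, rfl⟩⟩

lemma satisfies_eq_op {f : Ω.Op} {s t : Ω.arity f → Preterm Ω ℕ}
    (hs : ∀ i j (δ : ℝ≥0), edist i j = δ → M.Satisfies (.eq Γ (s i) δ (s j)))
    (ht : ∀ i j (δ : ℝ≥0), edist i j = δ → M.Satisfies (.eq Γ (t i) δ (t j)))
    (hst : ∀ i, M.Satisfies (.eq Γ (s i) ε (t i))) :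
    M.Satisfies (.eq Γ (.op f s) ε (.op f t)) := by
  choose v hv using fun i => satisfies_ok_iff.1 (hst i).ok_left
  choose w hw using fun i => satisfies_ok_iff.1 (hst i).ok_right
  refine (satisfies_eq_iff_of_mem
    (M.mem_interp_op.2 ⟨v, hv, lipschitzWith_of_satisfies hv hs, rfl⟩)
    (M.mem_interp_op.2 ⟨w, hw, lipschitzWith_of_satisfies hw ht, rfl⟩)).2 fun α => ?_
  exact ((M.op f).edist_le _ _).trans
    (NExp.edist_le_iff.2 fun i => (satisfies_eq_iff_of_mem (hv i) (hw i)).1 (hst i) α)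

lemma mem_interp_subst {σ : ℕ → Preterm Ω ℕ} {v : ℕ → M.Assignment Γ → M.space}
    (hv : ∀ x, v x ∈ M.interp Γ (σ x)) (hΔ : ∀ α, Δ.Sat fun x => v x α)
    {w : M.Assignment Δ → M.space} (hw : w ∈ M.interp Δ s) :
    (fun α => w ⟨fun x => v x α, hΔ α⟩) ∈ M.interp Γ (s.subst σ) := by
  induction s generalizing w with
  | var x =>
    obtain rfl := M.mem_interp_var.1 hw
    exact hv x
  | op f t ih =>
    obtain ⟨u, hu, h, rfl⟩ := M.mem_interp_op.1 hw
    exact M.mem_interp_op.2 ⟨fun i α => u i ⟨fun x => v x α, hΔ α⟩, fun i => ih i (hu i),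
      fun α => h _, rfl⟩

lemma Satisfies.subst {σ : ℕ → Preterm Ω ℕ} (hok : ∀ x, M.Satisfies (.ok Γ (σ x)))
    (hσ : ∀ x δ y, (x, δ, y) ∈ Δ.eqs → M.Satisfies (.eq Γ (σ x) δ (σ y)))
    (hst : M.Satisfies (.eq Δ s ε t)) : M.Satisfies (.eq Γ (s.subst σ) ε (t.subst σ)) := by
  choose v hv using fun x => satisfies_ok_iff.1 (hok x)
  have hΔ (α : M.Assignment Γ) : Δ.Sat fun x => v x α := fun x δ y hxy =>
    (satisfies_eq_iff_of_mem (hv x) (hv y)).1 (hσ x δ y hxy) α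
  obtain ⟨w, hw⟩ := satisfies_ok_iff.1 hst.ok_left
  obtain ⟨w', hw'⟩ := satisfies_ok_iff.1 hst.ok_right
  rw [satisfies_eq_iff_of_mem hw hw'] at hst
  exact (satisfies_eq_iff_of_mem (mem_interp_subst hv hΔ hw) (mem_interp_subst hv hΔ hw')).2
    fun α => hst _

theorem satisfies_of_deducible {S : Set (Judgment Ω)} (hS : ∀ J ∈ S, M.Satisfies J)
    {J : Judgment Ω} (hJ : Deducible S J) : M.Satisfies J := by
  induction hJ with
  | ax h => exact hS _ h
  | var => trivial
  | assum Γ x ε y h =>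
    exact (satisfies_eq_iff_of_mem (M.mem_interp_var.2 rfl) (M.mem_interp_var.2 rfl)).2
      fun α => α.2 _ _ _ h
  | refl Γ t _ ih =>
    obtain ⟨v, hv⟩ := satisfies_ok_iff.1 ih
    exact (satisfies_eq_iff_of_mem hv hv).2 fun α => by simp
  | symm Γ s t ε _ ih =>
    obtain ⟨v, hv⟩ := satisfies_ok_iff.1 ih.ok_left
    obtain ⟨w, hw⟩ := satisfies_ok_iff.1 ih.ok_right
    rw [satisfies_eq_iff_of_mem hv hw] at ih
    exact (satisfies_eq_iff_of_mem hw hv).2 fun α => (edist_comm _ _).trans_le (ih α)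
  | triang _ _ _ _ _ _ _ _ ih₁ ih₂ => exact ih₁.triang ih₂
  | max _ _ _ _ _ hε _ ih => exact ⟨ih.ok_left, ih.ok_right, ih.2.2.trans (by exact_mod_cast hε.le)⟩
  | cont _ _ _ _ _ ih => exact satisfies_of_forall_lt ih
  | nexp _ _ _ _ _ _ _ _ ihs iht ihst => exact satisfies_eq_op ihs iht ihst
  | subst _ _ _ _ _ _ _ _ _ ihok ihσ ihst => exact Satisfies.subst ihok ihσ ihst
  | app _ _ _ _ _ ihok iht => exact satisfies_ok_op ihok iht

end SigModel

/-! ### Metric equational theories from axioms and from models -/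

namespace Deducible

variable {Ω : Signature.{u}} {S S' : Set (Judgment Ω)} {Γ Δ : Context ℕ} {s t : Preterm Ω ℕ}

lemma of_forall_deducible (h : ∀ J ∈ S, Deducible S' J) {J : Judgment Ω} (hJ : Deducible S J) :
    Deducible S' J := by
  induction hJ with
  | ax hJ => exact h _ hJ
  | var Γ x => exact .var Γ x
  | assum Γ x ε y h => exact .assum Γ x ε y h
  | refl Γ t _ ih => exact .refl Γ t ih
  | symm Γ s t ε _ ih => exact .symm Γ s t ε ih
  | triang Γ s t r ε ε' _ _ ih₁ ih₂ => exact .triang Γ s t r ε ε' ih₁ ih₂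
  | max Γ s t ε ε' hε _ ih => exact .max Γ s t ε ε' hε ih
  | cont Γ s t ε _ ih => exact .cont Γ s t ε ih
  | nexp Γ f s t ε _ _ _ ihs iht ihst => exact .nexp Γ f s t ε ihs iht ihst
  | subst Γ Δ σ s t ε _ _ _ ihok ihσ ihst => exact .subst Γ Δ σ s t ε ihok ihσ ihst
  | app Γ f t _ _ ihok iht => exact .app Γ f t ihok iht

lemma eq_mono {ε ε' : ℝ≥0} (h : ε ≤ ε') (hst : Deducible S (.eq Γ s ε t)) :
    Deducible S (.eq Γ s ε' t) := by
  rcases h.eq_or_lt with rfl | hlt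
  · exact hst
  · exact .max _ _ _ _ _ hlt hst

lemma ok_subst (hS : ∀ Γ t, .ok Γ t ∉ S) {σ : ℕ → Preterm Ω ℕ}
    (hok : ∀ x, Deducible S (.ok Γ (σ x)))
    (hσ : ∀ x δ y, (x, δ, y) ∈ Δ.eqs → Deducible S (.eq Γ (σ x) δ (σ y)))
    (hs : Deducible S (.ok Δ s)) : Deducible S (.ok Γ (s.subst σ)) := by
  induction s with
  | var x => exact hok x
  | op f t ih =>
    cases hs with
    | ax h => exact absurd h (hS _ _)
    | app _ _ _ h h' =>
      exact .app _ _ _ (fun i => ih i (h i)) fun i j δ hδ =>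
        .subst _ _ _ _ _ _ hok hσ (h' i j δ hδ)

lemma ok_of_eq (hS : ∀ Γ t, .ok Γ t ∉ S)
    (hS' : ∀ Γ s ε t, .eq Γ s ε t ∈ S → Deducible S (.ok Γ s) ∧ Deducible S (.ok Γ t))
    {ε : ℝ≥0} (h : Deducible S (.eq Γ s ε t)) :
    Deducible S (.ok Γ s) ∧ Deducible S (.ok Γ t) := by
  generalize hJ : Judgment.eq Γ s ε t = J at h
  induction h generalizing Γ s ε t with
  | ax h => subst hJ; exact hS' _ _ _ _ h
  | assum => cases hJ; exact ⟨.var _ _, .var _ _⟩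
  | refl _ _ h => cases hJ; exact ⟨h, h⟩
  | symm _ _ _ _ _ ih => cases hJ; exact (ih rfl).symm
  | triang _ _ _ _ _ _ _ _ ih₁ ih₂ => cases hJ; exact ⟨(ih₁ rfl).1, (ih₂ rfl).2⟩
  | max _ _ _ _ _ _ _ ih => cases hJ; exact ih rfl
  | cont _ _ _ ε _ ih => cases hJ; exact ih (ε + 1) (lt_add_one ε) rfl
  | nexp _ _ _ _ _ hs ht _ _ _ ih =>
    cases hJ
    exact ⟨.app _ _ _ (fun i => (ih i rfl).1) hs, .app _ _ _ (fun i => (ih i rfl).2) ht⟩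
  | subst _ _ _ _ _ _ hok hσ _ _ _ ih =>
    cases hJ
    exact ⟨ok_subst hS hok hσ (ih rfl).1, ok_subst hS hok hσ (ih rfl).2⟩
  | var | app => cases hJ

end Deducible

lemma isMET_of_axioms {Ω : Signature.{u}} {S : Set (Judgment Ω)} (hS : ∀ Γ t, .ok Γ t ∉ S)
    (hS' : ∀ Γ s ε t, .eq Γ s ε t ∈ S → Deducible S (.ok Γ s) ∧ Deducible S (.ok Γ t)) :
    IsMET {J | Deducible S J} := by
  refine ⟨fun Γ s ε t h => Deducible.ok_of_eq hS hS' h, Set.Subset.antisymm ?_ ?_⟩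
  · refine fun J hJ => hJ.of_forall_deducible fun J h => ?_
    cases J with
    | ok Γ t => exact absurd h (hS _ _)
    | eq Γ s ε t => exact .ax ⟨.ax h, Γ, s, ε, t, rfl⟩
  · exact fun J hJ => hJ.of_forall_deducible fun J h => h.1

lemma isMET_of_models {Ω : Signature.{u}} {ι : Type w} (M : ι → SigModel Ω) :
    IsMET {J | ∀ i, (M i).Satisfies J} := by
  set T := {J | ∀ i, (M i).Satisfies J}
  have deducible_eq {Γ s ε t} (h : .eq Γ s ε t ∈ T) : Deducible (equational T) (.eq Γ s ε t) :=
    .ax ⟨h, Γ, s, ε, t, rfl⟩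
  have deducible_ok {Γ t} (h : .ok Γ t ∈ T) : Deducible (equational T) (.ok Γ t) := by
    induction t with
    | var x => exact .var _ _
    | op f t ih =>
      refine .app _ _ _ (fun a => ih a fun i => (h i).fst a) fun a b δ hδ =>
        deducible_eq fun i => ?_
      obtain ⟨hdom, hdist⟩ := h i
      exact ⟨hdom a, hdom b, (hdist a b).trans hδ.le⟩
  refine ⟨fun Γ s ε t h => ⟨fun i => (h i).ok_left, fun i => (h i).ok_right⟩,
    Set.Subset.antisymm ?_ fun J hJ i => SigModel.satisfies_of_deducible (fun J h => h.1 i) hJ⟩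
  rintro (⟨Γ, t⟩ | ⟨Γ, s, ε, t⟩) h
  exacts [deducible_ok h, deducible_eq h]

/-! ### Operations indexed by metric cardinals -/

/-- The nonexpansive map `A → [V, X]` obtained from `V → [A, X]` by exchanging the arguments. -/
def NExp.flip {V : Type v} {A : Type w} {X : Type v'} [EMetricSpace V] [EMetricSpace A]
    [EMetricSpace X] (f : NExp V (NExp A X)) : NExp A (NExp V X) where
  toFun a := ⟨fun i => f i a, .of_edist_le fun i j =>
    (edist_apply_le _ _ a).trans (f.edist_le i j)⟩
  nonexp := .of_edist_le fun a b => edist_le_iff.2 fun i => (f i).edist_le a b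

/-- The signature whose operation symbols of arity `C` are the elements of `P C`. The signatures
of a Lawvere theory and of a monad both have this form. -/
@[reducible]
def opSignature (P : MetricCardinal → Type u) : Signature.{u} where
  Op := Σ C, P C
  arity f := f.1

section OpSignature

variable {P : MetricCardinal → Type u} {C D : MetricCardinal}

/-- The preterm `f(x₀, x₁, …)` for an operation symbol `f ∈ P C`. -/
def basicTerm (f : P C) : Preterm (opSignature P) ℕ :=
  .op (Ω := opSignature P) ⟨C, f⟩ fun i => .var i.val

namespace SigModel

variable (M : SigModel (opSignature P))

/-- The interpretation of the operation symbol `f ∈ P C`, as a map on `[C, M]`. -/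
def operation (f : P C) : NExp (NExp C M.space) M.space := M.op ⟨C, f⟩

variable {M}

/-- The nonexpansive map `C → M` given by an assignment that satisfies the context of `C`. -/
def Assignment.restrict (α : M.Assignment C.context) : NExp C M.space :=
  ⟨fun i => α.1 i.val, .of_edist_le fun i j => ennreal_le_of_forall_eq_coe fun δ hδ =>
    α.2 _ _ _ ⟨⟨(i, j), by simp [hδ]⟩, by simp [hδ]⟩⟩

/-- The assignment that extends a nonexpansive map `C → M` by a constant value on the variables
that do not occur in the context of `C`. -/
def Assignment.extend (m : NExp C M.space) (a : M.space) : M.Assignment C.context :=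
  ⟨fun k => open Classical in if h : (k : ℕ∞) < C.card then m ⟨k, h⟩ else a, by
    rintro _ _ _ ⟨⟨⟨i, j⟩, hij⟩, h⟩
    obtain ⟨rfl, rfl, rfl⟩ := by simpa using h
    dsimp only
    rw [dif_pos i.2, dif_pos j.2, ENNReal.coe_toNNReal hij]
    exact m.edist_le _ _⟩

lemma Assignment.extend_apply (m : NExp C M.space) (a : M.space) (i : C) :
    (extend m a).1 i.val = m i :=
  dif_pos i.2

lemma Assignment.restrict_extend (m : NExp C M.space) (a : M.space) : (extend m a).restrict = m :=
  DFunLike.ext _ _ fun i => extend_apply m a i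

variable (M) in
lemma mem_interp_basicTerm (f : P C) :
    (fun α => M.operation f α.restrict) ∈ M.interp C.context (basicTerm f) :=
  M.mem_interp_op.2
    ⟨fun i α => α.1 i.val, fun _ => M.mem_interp_var.2 rfl, fun α => α.restrict.nonexp, rfl⟩

lemma satisfies_dist_iff (f f' : P C) (ε : ℝ≥0) :
    M.Satisfies (.eq C.context (basicTerm f) ε (basicTerm f')) ↔
      edist (M.operation f) (M.operation f') ≤ ε := by
  rw [satisfies_eq_iff_of_mem (M.mem_interp_basicTerm f) (M.mem_interp_basicTerm f'),
    NExp.edist_le_iff]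
  refine ⟨fun h m => ?_, fun h α => h _⟩
  simpa only [Assignment.restrict_extend] using h (.extend m (M.operation f m))

lemma satisfies_proj_iff (f : P C) (i : C) :
    M.Satisfies (.eq C.context (basicTerm f) 0 (.var i.val)) ↔ ∀ m, M.operation f m = m i := by
  rw [satisfies_eq_iff_of_mem (M.mem_interp_basicTerm f) (M.mem_interp_var.2 rfl)]
  simp only [ENNReal.coe_zero, nonpos_iff_eq_zero, edist_eq_zero]
  refine ⟨fun h m => ?_, fun h α => h _⟩
  simpa only [Assignment.restrict_extend, Assignment.extend_apply] using
    h (.extend m (M.operation f m))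

lemma mem_interp_comp_iff (f : P C) (g : C → P D) {w : M.Assignment D.context → M.space} :
    w ∈ M.interp D.context (.op (Ω := opSignature P) ⟨C, f⟩ fun i => basicTerm (g i)) ↔
      ∃ h : LipschitzWith 1 fun i => M.operation (g i),
        w = fun α => M.operation f (NExp.flip ⟨_, h⟩ α.restrict) := by
  rw [mem_interp_op]
  constructor
  · rintro ⟨v, hv, h, rfl⟩
    obtain rfl : v = fun i α => M.operation (g i) α.restrict :=
      funext fun i => Part.mem_unique (hv i) (M.mem_interp_basicTerm (g i))
    refine ⟨.of_edist_le fun i j => NExp.edist_le_iff.2 fun m => ?_, rfl⟩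
    simpa only [Assignment.restrict_extend] using
      lipschitzWith_one_iff.1 (h (.extend m (M.operation (g i) m))) i j
  · rintro ⟨h, rfl⟩
    exact ⟨fun i α => M.operation (g i) α.restrict, fun i => M.mem_interp_basicTerm (g i),
      fun α => (NExp.flip ⟨_, h⟩ α.restrict).nonexp, rfl⟩

lemma satisfies_comp_iff (f : P C) (g : C → P D) (k : P D) :
    M.Satisfies (.eq D.context (.op (Ω := opSignature P) ⟨C, f⟩ fun i => basicTerm (g i)) 0
      (basicTerm k)) ↔
    ∃ h : LipschitzWith 1 fun i => M.operation (g i),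
      ∀ m, M.operation f (NExp.flip ⟨_, h⟩ m) = M.operation k m := by
  constructor
  · intro hM
    obtain ⟨w, hw⟩ := satisfies_ok_iff.1 hM.ok_left
    obtain ⟨h, rfl⟩ := (mem_interp_comp_iff f g).1 hw
    rw [satisfies_eq_iff_of_mem hw (M.mem_interp_basicTerm k)] at hM
    refine ⟨h, fun m => ?_⟩
    simpa only [Assignment.restrict_extend, ENNReal.coe_zero, nonpos_iff_eq_zero, edist_eq_zero]
      using hM (.extend m (M.operation k m))
  · rintro ⟨h, hfg⟩
    refine (satisfies_eq_iff_of_mem ((mem_interp_comp_iff f g).2 ⟨h, rfl⟩)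
      (M.mem_interp_basicTerm k)).2 fun α => ?_
    rw [hfg, edist_self]
    exact bot_le

end SigModel

end OpSignature

/-! ### Powers -/

lemma exists_metricCardinal (A : Type v) [EMetricSpace A] [Countable A] :
    ∃ C : MetricCardinal, Nonempty (C ≃ᵢ A) := by
  obtain ⟨n, ⟨e⟩⟩ : ∃ n : ℕ∞, Nonempty ({k : ℕ // (k : ℕ∞) < n} ≃ A) := by
    rcases finite_or_infinite A with _ | _
    · obtain ⟨n, ⟨e⟩⟩ := Finite.exists_equiv_fin A
      exact ⟨n, ⟨(Equiv.subtypeEquivRight fun _ => Nat.cast_lt).trans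
        (Fin.equivSubtype.symm.trans e.symm)⟩⟩
    · obtain ⟨e⟩ := nonempty_equiv_of_countable (α := ℕ) (β := A)
      exact ⟨⊤, ⟨(Equiv.subtypeUnivEquiv ENat.natCast_lt_top).trans e⟩⟩
  exact ⟨⟨n, EMetricSpace.induced e e.injective inferInstance⟩, ⟨⟨e, fun _ _ => rfl⟩⟩⟩

lemma edist_withLp_one {V : Type v} {W : Type w} [EMetricSpace V] [EMetricSpace W]
    (p q : WithLp 1 (V × W)) : edist p q = edist p.fst q.fst + edist p.snd q.snd := by
  simp [WithLp.prod_edist_eq_add (p := 1) (by simp)]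

section MetCategory

variable {C : Type w} [MetCategory.{v} C]

lemma edist_comp_left_le {X Y Z : C} (f : X ⟶ Y) (g g' : Y ⟶ Z) :
    edist (f ≫ g) (f ≫ g') ≤ edist g g' := by
  simpa using MetCategory.edist_comp_le f f g g'

lemma edist_comp_right_le {X Y Z : C} (f f' : X ⟶ Y) (g : Y ⟶ Z) :
    edist (f ≫ g) (f' ≫ g) ≤ edist f f' := by
  simpa using MetCategory.edist_comp_le f f' g g

namespace IsPower

variable {V : Type v'} {W : Type w'} [EMetricSpace V] [EMetricSpace W] {X Y P : C}
  {l : V → (P ⟶ X)}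

lemma edist_le (hl : IsPower V X P l) {A : C} {h h' : A ⟶ P} {r : ℝ≥0∞}
    (H : ∀ a, edist (h ≫ l a) (h' ≫ l a) ≤ r) : edist h h' ≤ r := by
  rw [hl.isometry]
  exact supDist_le_iff.2 H

lemma hom_ext (hl : IsPower V X P l) {A : C} {h h' : A ⟶ P}
    (H : ∀ a, h ≫ l a = h' ≫ l a) : h = h' :=
  eq_of_edist_eq_zero (le_bot_iff.1 (hl.edist_le fun a => by rw [H, edist_self]; exact le_rfl))

lemma reindex (hl : IsPower V X P l) (e : W ≃ᵢ V) : IsPower W X P fun b => l (e b) where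
  nonexp := .of_edist_le fun a b =>
    (lipschitzWith_one_iff.1 hl.nonexp _ _).trans_eq (e.isometry a b)
  isometry A h h' := by
    rw [hl.isometry]
    exact (e.surjective.iSup_comp fun a => edist (h ≫ l a) (h' ≫ l a)).symm
  lift A g hg := by
    obtain ⟨h, hh⟩ := hl.lift A (fun a => g (e.symm a)) (.of_edist_le fun a b =>
      (lipschitzWith_one_iff.1 hg _ _).trans_eq (e.symm.isometry a b))
    exact ⟨h, fun b => by rw [hh, e.symm_apply_apply]⟩

lemma of_reindex (e : W ≃ᵢ V) (hl : IsPower W X P fun b => l (e b)) : IsPower V X P l := by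
  simpa using hl.reindex e.symm

/-- `(X ^ W) ^ V = X ^ (V ⊗ W)`, where `V ⊗ W` is `WithLp 1 (V × W)`. -/
lemma comp {l : V → (P ⟶ Y)} (hl : IsPower V Y P l) {l' : W → (Y ⟶ X)} (hl' : IsPower W X Y l') :
    IsPower (WithLp 1 (V × W)) X P fun q => l q.fst ≫ l' q.snd where
  nonexp := .of_edist_le fun p q => by
    rw [edist_withLp_one]
    exact (MetCategory.edist_comp_le _ _ _ _).trans (add_le_add
      (lipschitzWith_one_iff.1 hl.nonexp _ _) (lipschitzWith_one_iff.1 hl'.nonexp _ _))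
  isometry A h h' := by
    apply le_antisymm
    · refine hl.edist_le fun v => hl'.edist_le fun w => ?_
      rw [Category.assoc, Category.assoc]
      exact supDist_le_iff.1 le_rfl (WithLp.toLp 1 (v, w))
    · exact supDist_le_iff.2 fun q => edist_comp_right_le _ _ _
  lift A g hg := by
    replace hg (v v' w w') := lipschitzWith_one_iff.1 hg (WithLp.toLp 1 (v, w)) (.toLp 1 (v', w'))
    simp only [edist_withLp_one] at hg
    choose k hk using fun v => hl'.lift A (fun w => g (.toLp 1 (v, w)))
      (.of_edist_le fun w w' => (hg _ _ _ _).trans_eq (by simp))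
    obtain ⟨h, hh⟩ := hl.lift A k (.of_edist_le fun v v' => hl'.edist_le fun w => by
      rw [hk, hk]
      exact (hg _ _ _ _).trans_eq (by simp))
    exact ⟨h, fun q => by rw [← Category.assoc, hh, hk]; rfl⟩

lemma exists_iso {Q : C} (hl : IsPower V X P l) {l' : V → (Q ⟶ X)} (hl' : IsPower V X Q l') :
    ∃ i : P ≅ Q, ∀ a, i.hom ≫ l' a = l a := by
  obtain ⟨f, hf⟩ := hl'.lift P l hl.nonexp
  obtain ⟨g, hg⟩ := hl.lift Q l' hl'.nonexp
  exact ⟨⟨f, g, hl.hom_ext fun a => by rw [Category.assoc, hg, hf, Category.id_comp],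
    hl'.hom_ext fun a => by rw [Category.assoc, hf, hg, Category.id_comp]⟩, hf⟩

end IsPower

lemma isPower_unit (X : C) : IsPower Unit X X fun _ => 𝟙 X where
  nonexp := .const' _
  isometry A h h' := by simp [supDist]
  lift A g _ := ⟨g ⟨⟩, by simp⟩

lemma PreservesCountablePowers.isPower_map {D : Type w'} [MetCategory.{v'} D] {F : C ⥤ D}
    (hF : PreservesCountablePowers.{u} F) {V : Type*} [EMetricSpace V] [Countable V] {X P : C}
    {l : V → (P ⟶ X)} (hl : IsPower V X P l) :
    IsPower V (F.obj X) (F.obj P) fun a => F.map (l a) := by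
  obtain ⟨C, ⟨e⟩⟩ := exists_metricCardinal V
  let e' : ULift.{u} C ≃ᵢ V := ⟨Equiv.ulift.trans e, fun a b => e.isometry a.down b.down⟩
  exact .of_reindex e' (hF _ _ _ _ (hl.reindex e'))

end MetCategory

/-- A point of a metric space, as a map from the one-point space. -/
def Met.ofPoint {X : Met.{u}} (x : X) : (⟨PUnit⟩ : Met.{u}) ⟶ X :=
  ConcreteCategory.ofHom (C := Met) ⟨fun _ => x, .const' x⟩

lemma Met.edist_ofPoint {X : Met.{u}} (x y : X) : edist (ofPoint x) (ofPoint y) = edist x y :=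
  iSup_const (ι := PUnit) (a := edist x y)

section Met

variable {V : Type v} [EMetricSpace V] {X P : Met.{u}} {l : V → (P ⟶ X)}

lemma IsPower.edist_point_le (hl : IsPower V X P l) {p q : P} {r : ℝ≥0∞}
    (h : ∀ a, edist (l a p) (l a q) ≤ r) : edist p q ≤ r := by
  rw [← Met.edist_ofPoint]
  exact hl.edist_le fun a => (Met.edist_ofPoint (l a p) (l a q)).trans_le (h a)

lemma IsPower.point_ext (hl : IsPower V X P l) {p q : P} (h : ∀ a, l a p = l a q) : p = q :=
  eq_of_edist_eq_zero (le_bot_iff.1 (hl.edist_point_le fun a => by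
    rw [h, edist_self]; exact le_rfl))

lemma IsPower.exists_point (hl : IsPower V X P l) (m : NExp V X) : ∃ p : P, ∀ a, l a p = m a := by
  obtain ⟨h, hh⟩ := hl.lift ⟨PUnit⟩ (fun a => Met.ofPoint (m a)) (.of_edist_le fun a b => by
    rw [Met.edist_ofPoint]
    exact m.edist_le a b)
  exact ⟨h PUnit.unit, fun a => ConcreteCategory.congr_hom (hh a) PUnit.unit⟩

lemma Met.isPower_of_points (hl : LipschitzWith 1 l)
    (h : ∀ (p q : P) (r : ℝ≥0∞), (∀ a, edist (l a p) (l a q) ≤ r) → edist p q ≤ r)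
    (h' : ∀ m : NExp V X, ∃ p : P, ∀ a, l a p = m a) : IsPower V X P l where
  nonexp := hl
  isometry A f g := by
    apply le_antisymm
    · refine Met.edist_le_iff.2 fun x => h _ _ _ fun a => ?_
      exact (Met.edist_apply_apply_le (f ≫ l a) (g ≫ l a) x).trans (supDist_le_iff.1 le_rfl a)
    · exact supDist_le_iff.2 fun a => edist_comp_right_le _ _ _
  lift A g hg := by
    choose k hk using fun x : A => h' ⟨fun a => g a x, .of_edist_le fun a b =>
      (Met.edist_apply_apply_le _ _ x).trans (lipschitzWith_one_iff.1 hg a b)⟩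
    refine ⟨ConcreteCategory.ofHom ⟨k, .of_edist_le fun x y => h _ _ _ fun a => ?_⟩,
      fun a => ConcreteCategory.hom_ext _ _ fun x => hk x a⟩
    rw [hk, hk]
    exact Met.edist_apply_le (g a) x y

end Met

lemma CMet.isPower_const (A : CMet.{u}) : IsPower A.obj (Opposite.op CMet.point) (Opposite.op A)
    (fun a => (CMet.const a).op) where
  nonexp := .of_edist_le fun a b => iSup_le fun _ => le_rfl
  isometry B h h' := by
    change (⨆ a, edist (h.unop.hom a) (h'.unop.hom a)) =
      ⨆ a, ⨆ _ : PUnit, edist (h.unop.hom a) (h'.unop.hom a)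
    simp only [iSup_const]
  lift B g hg :=
    ⟨(ObjectProperty.homMk (P := fun X : Met.{u} => Countable X) (X := A) (Y := B.unop)
      ⟨fun a => (g a).unop.hom PUnit.unit, .of_edist_le fun a b =>
        (NExp.edist_apply_le _ _ PUnit.unit).trans (lipschitzWith_one_iff.1 hg a b)⟩).op,
      fun _ => rfl⟩

namespace LawvereTheory

variable (L : LawvereTheory.{u})

/-- The projection `x ^ C ⟶ x` for an element of a metric cardinal `C`. -/
def cardProj {C : MetricCardinal} (i : C) : L.pow C.toCMet ⟶ L.x :=
  L.proj (A := C.toCMet) (ULift.up i)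

lemma isPower_proj (A : CMet.{u}) : IsPower A.obj L.x (L.pow A) fun a => L.proj a :=
  have := A.property
  L.preservesPowers _ _ _ _ (CMet.isPower_const A)

lemma isPower_cardProj (C : MetricCardinal) : IsPower C L.x (L.pow C.toCMet) L.cardProj :=
  (L.isPower_proj C.toCMet).reindex ⟨Equiv.ulift.symm, fun _ _ => rfl⟩

lemma exists_isPower (X : L.Obj) :
    ∃ (C : MetricCardinal) (l : C → (X ⟶ L.x)), IsPower C L.x X l := by
  obtain ⟨⟨A⟩, rfl⟩ := L.bijective_obj.2 X
  have := A.property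
  obtain ⟨C, ⟨e⟩⟩ := exists_metricCardinal A.obj
  exact ⟨C, _, (L.isPower_proj A).reindex e⟩

lemma exists_iso_pow {V : Type v} [EMetricSpace V] [Countable V] {X : L.Obj} {l : V → (X ⟶ L.x)}
    (hl : IsPower V L.x X l) : ∃ (C : MetricCardinal) (e : C ≃ᵢ V) (i : X ≅ L.pow C.toCMet),
      ∀ c, i.hom ≫ L.cardProj c = l (e c) := by
  obtain ⟨C, ⟨e⟩⟩ := exists_metricCardinal V
  exact ⟨C, e, (hl.reindex e).exists_iso (L.isPower_cardProj C)⟩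

variable {L}

/-- The components of a morphism to `x ^ C`. -/
def components {C : MetricCardinal} {X : L.Obj} (g : X ⟶ L.pow C.toCMet) : NExp C (X ⟶ L.x) :=
  ⟨fun i => g ≫ L.cardProj i, .of_edist_le fun i j => (edist_comp_left_le _ _ _).trans
    (lipschitzWith_one_iff.1 (L.isPower_cardProj C).nonexp i j)⟩

/-! ### The theory of a Lawvere theory is a metric equational theory -/

lemma deducible_ok_basic {C : MetricCardinal} (f : L.pow C.toCMet ⟶ L.x)
    (S : Set (Judgment L.signature)) : Deducible S (.ok C.context (L.basic f)) :=
  .app _ _ _ (fun i => .var _ _) fun (i j : C) δ (hδ : edist i j = δ) =>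
    .assum _ _ _ _ ⟨⟨(i, j), by simp [hδ]⟩, by simp [hδ]⟩

lemma deducible_eq_basic {C : MetricCardinal} {f f' : L.pow C.toCMet ⟶ L.x} {δ : ℝ≥0}
    (h : edist f f' ≤ δ) :
    Deducible {J | L.Axioms J} (.eq C.context (L.basic f) δ (L.basic f')) := by
  have hne : edist f f' ≠ ⊤ := ne_top_of_le_ne_top ENNReal.coe_ne_top h
  exact .eq_mono (ENNReal.toNNReal_mono ENNReal.coe_ne_top h)
    (.ax (.dist f f' _ (ENNReal.coe_toNNReal hne).symm))

variable (L) in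
theorem isMET_theory : IsMET L.theory := by
  refine isMET_of_axioms (fun Γ t h => by cases h) fun Γ s ε t h => ?_
  cases h with
  | dist f f' ε h => exact ⟨deducible_ok_basic f _, deducible_ok_basic f' _⟩
  | proj i => exact ⟨deducible_ok_basic _ _, .var _ _⟩
  | @comp C D f g g' h =>
    obtain rfl : ⇑(components g') = g := funext h
    exact ⟨.app _ _ _ (fun i => deducible_ok_basic _ _) fun (i j : C) δ hδ =>
      deducible_eq_basic (((components g').edist_le i j).trans_eq hδ), deducible_ok_basic _ _⟩

end LawvereTheory

/-! ### Points of a model of the theory -/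

section Equivalence

/-- The operation symbols of arity `C`: the signature of the theory of `L` is
`opSignature L.Operation`. -/
abbrev LawvereTheory.Operation (L : LawvereTheory.{u}) (C : MetricCardinal) : Type u :=
  L.pow C.toCMet ⟶ L.x

variable {L : LawvereTheory.{u}}

open LawvereTheory

namespace TheoryModel

section Operation

variable {C D : MetricCardinal} (N : TheoryModel L.theory)

/-- The operation of a model of the theory given by a morphism `x ^ C ⟶ x`. -/
def operation (f : L.Operation C) : NExp (NExp C N.obj.space) N.obj.space :=
  SigModel.operation (P := L.Operation) N.obj f

lemma edist_operation_le (f f' : L.Operation C) :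
    edist (N.operation f) (N.operation f') ≤ edist f f' :=
  ennreal_le_of_forall_eq_coe fun ε h =>
    (SigModel.satisfies_dist_iff (P := L.Operation) f f' ε).1 (N.property _ (.ax (.dist _ _ _ h)))

lemma operation_cardProj (i : C) (m : NExp C N.obj.space) : N.operation (L.cardProj i) m = m i :=
  (SigModel.satisfies_proj_iff (P := L.Operation) (L.cardProj i) i).1
    (N.property _ (.ax (.proj i))) m

/-- The evaluation of all the operations of arity `C` at a tuple. -/
def evalAt (m : NExp C N.obj.space) : NExp (L.Operation C) N.obj.space :=
  ⟨fun f => N.operation f m, .of_edist_le fun f f' =>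
    (NExp.edist_apply_le _ _ m).trans (N.edist_operation_le f f')⟩

lemma operation_comp (g : L.pow D.toCMet ⟶ L.pow C.toCMet) (f : L.Operation C)
    (m : NExp D N.obj.space) :
    N.operation (g ≫ f) m = N.operation f ((components g).comp (N.evalAt m)) := by
  obtain ⟨_, h⟩ := (SigModel.satisfies_comp_iff (P := L.Operation) f (components g) (g ≫ f)).1
    (N.property _ (.ax (.comp _ _ g fun i => rfl)))
  exact (h m).symm

variable {N}

lemma map_operation {M : TheoryModel L.theory} (φ : M ⟶ N) (f : L.Operation C)
    (m : NExp C M.obj.space) :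
    φ.hom.toNExp (M.operation f m) = N.operation f (m.comp φ.hom.toNExp) :=
  φ.hom.map_op ⟨C, f⟩ m

end Operation

/-- A point of a model `N` of the theory at an object `X`: an interpretation in `N` of the
morphisms `X ⟶ x` that is compatible with the operations, in other words a homomorphism to `N` from
the model represented by `X`. By `Point.edist_le` and `Point.exists_eval`, the points at a power
`x ^ V` are the nonexpansive maps `V → N`. -/
@[ext]
structure Point (N : TheoryModel L.theory) (X : L.Obj) where
  eval : NExp (X ⟶ L.x) N.obj.space
  eval_comp {C : MetricCardinal} (τ : X ⟶ L.pow C.toCMet) (f : L.Operation C) :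
    eval (τ ≫ f) = N.operation f ((components τ).comp eval)

namespace Point

variable {N : TheoryModel L.theory} {X Y : L.Obj}

instance : EMetricSpace (Point N X) :=
  .induced eval (fun _ _ h => Point.ext h) inferInstance

lemma edist_le_iff {p q : Point N X} {r : ℝ≥0∞} :
    edist p q ≤ r ↔ ∀ g, edist (p.eval g) (q.eval g) ≤ r :=
  NExp.edist_le_iff

/-- The point at `x ^ C` given by a tuple. -/
def ofTuple {C : MetricCardinal} (m : NExp C N.obj.space) : Point N (L.pow C.toCMet) :=
  ⟨N.evalAt m, fun τ f => N.operation_comp τ f m⟩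

/-- The action of the morphisms of the Lawvere theory on points. -/
def map (h : X ⟶ Y) (p : Point N X) : Point N Y where
  eval := ⟨fun g => p.eval (h ≫ g), .of_edist_le fun g g' =>
    (p.eval.edist_le _ _).trans (edist_comp_left_le h g g')⟩
  eval_comp τ f := by
    rw [NExp.mk_apply, ← Category.assoc, p.eval_comp]
    congr 1
    exact DFunLike.ext _ _ fun i => congrArg p.eval (Category.assoc h τ _)

/-- The action of the homomorphisms of models on points. -/
def postcomp {N' : TheoryModel L.theory} (φ : N ⟶ N') (p : Point N X) : Point N' X :=
  ⟨p.eval.comp φ.hom.toNExp, fun τ f => by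
    rw [NExp.comp_apply, p.eval_comp, map_operation]
    rfl⟩

lemma edist_postcomp_le {N' : TheoryModel L.theory} (φ : N ⟶ N') (p q : Point N X) :
    edist (p.postcomp φ) (q.postcomp φ) ≤ edist p q :=
  edist_le_iff.2 fun g => (φ.hom.toNExp.edist_le _ _).trans (edist_le_iff.1 le_rfl g)

section IsPower

variable {V : Type v} [EMetricSpace V] [Countable V] {l : V → (X ⟶ L.x)}

lemma edist_le (hl : IsPower V L.x X l) {p q : Point N X} {r : ℝ≥0∞}
    (h : ∀ v, edist (p.eval (l v)) (q.eval (l v)) ≤ r) : edist p q ≤ r := by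
  obtain ⟨C, e, i, hi⟩ := L.exists_iso_pow hl
  refine edist_le_iff.2 fun g => ?_
  rw [← i.hom_inv_id_assoc g, eval_comp, eval_comp]
  refine (NExp.edist_le _ _ _).trans (NExp.edist_le_iff.2 fun c => ?_)
  change edist (p.eval (i.hom ≫ L.cardProj c)) (q.eval (i.hom ≫ L.cardProj c)) ≤ r
  rw [hi]
  exact h _

lemma ext_of_isPower (hl : IsPower V L.x X l) {p q : Point N X}
    (h : ∀ v, p.eval (l v) = q.eval (l v)) : p = q :=
  eq_of_edist_eq_zero (le_bot_iff.1 (edist_le hl fun v => by rw [h, edist_self]; exact le_rfl))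

lemma exists_eval (hl : IsPower V L.x X l) (m : NExp V N.obj.space) :
    ∃ p : Point N X, ∀ v, p.eval (l v) = m v := by
  obtain ⟨C, e, i, hi⟩ := L.exists_iso_pow hl
  let m' : NExp C N.obj.space :=
    ⟨fun c => m (e c), .of_edist_le fun c d => (m.edist_le _ _).trans_eq (e.isometry c d)⟩
  refine ⟨(ofTuple m').map i.inv, fun v => ?_⟩
  obtain ⟨c, rfl⟩ := e.surjective v
  change N.operation (i.inv ≫ l (e c)) m' = m' c
  rw [← hi, i.inv_hom_id_assoc, operation_cardProj]

end IsPower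

end Point

end TheoryModel

/-! ### From models of a Lawvere theory to models of its theory -/

namespace LawvereTheory

namespace Model

variable (M : L.Model)

lemma isPower_map {V : Type v} [EMetricSpace V] [Countable V] {X P : L.Obj} {l : V → (P ⟶ X)}
    (hl : IsPower V X P l) : IsPower V (M.obj.obj X) (M.obj.obj P) fun a => M.obj.map (l a) :=
  M.property.2.isPower_map hl

lemma edist_map_apply_le {X Y : L.Obj} (f g : X ⟶ Y) (p : M.obj.obj X) :
    edist (M.obj.map f p) (M.obj.map g p) ≤ edist f g :=
  (Met.edist_apply_apply_le _ _ p).trans (M.property.1 f g)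

section Tuple

variable {M} {C : MetricCardinal}

lemma exists_tuple (m : NExp C (M.obj.obj L.x)) :
    ∃ p : M.obj.obj (L.pow C.toCMet), ∀ i, M.obj.map (L.cardProj i) p = m i :=
  (M.isPower_map (L.isPower_cardProj C)).exists_point m

/-- The point of `M(x ^ C)` given by a tuple in `M(x)`. -/
def tuple (m : NExp C (M.obj.obj L.x)) : M.obj.obj (L.pow C.toCMet) :=
  (exists_tuple m).choose

lemma map_cardProj_tuple (m : NExp C (M.obj.obj L.x)) (i : C) :
    M.obj.map (L.cardProj i) (tuple m) = m i :=
  (exists_tuple m).choose_spec i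

lemma tuple_eq {m : NExp C (M.obj.obj L.x)} {p : M.obj.obj (L.pow C.toCMet)}
    (h : ∀ i, M.obj.map (L.cardProj i) p = m i) : tuple m = p :=
  (M.isPower_map (L.isPower_cardProj C)).point_ext fun i => by rw [map_cardProj_tuple, h]

lemma edist_tuple_le (m n : NExp C (M.obj.obj L.x)) : edist (tuple m) (tuple n) ≤ edist m n :=
  (M.isPower_map (L.isPower_cardProj C)).edist_point_le fun i => by
    rw [map_cardProj_tuple, map_cardProj_tuple]
    exact NExp.edist_apply_le m n i

end Tuple

/-- The space `M(x)` with its operations. -/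
def toSigModel : SigModel L.signature where
  space := M.obj.obj L.x
  op f := ⟨fun m => M.obj.map f.2 (tuple m), .of_edist_le fun m n =>
    (Met.edist_apply_le _ _ _).trans (edist_tuple_le m n)⟩

lemma satisfies_axioms {J : Judgment L.signature} (hJ : L.Axioms J) :
    M.toSigModel.Satisfies J := by
  cases hJ with
  | dist f f' ε h =>
    exact (SigModel.satisfies_dist_iff (P := L.Operation) f f' ε).2
      (NExp.edist_le_iff.2 fun m => (M.edist_map_apply_le f f' (tuple m)).trans_eq h)
  | proj i =>
    exact (SigModel.satisfies_proj_iff (P := L.Operation) (L.cardProj i) i).2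
      fun m => map_cardProj_tuple m i
  | @comp C D f g g' h =>
    obtain rfl : ⇑(components g') = g := funext h
    refine (SigModel.satisfies_comp_iff (P := L.Operation) f _ (g' ≫ f)).2
      ⟨.of_edist_le fun i j => NExp.edist_le_iff.2 fun m =>
        (M.edist_map_apply_le _ _ (tuple m)).trans ((components g').edist_le i j), fun m => ?_⟩
    change M.obj.map f (tuple _) = M.obj.map (g' ≫ f) (tuple m)
    rw [M.obj.map_comp, comp_apply]
    congr 1
    refine tuple_eq fun i => ?_
    rw [← comp_apply, ← M.obj.map_comp]
    rfl

lemma app_tuple {M N : L.Model} (φ : M ⟶ N) {C : MetricCardinal} (m : NExp C (M.obj.obj L.x)) :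
    φ.hom.app _ (tuple m) = tuple (M := N) (m.comp (φ.hom.app L.x)) :=
  (tuple_eq fun i => by
    rw [← NatTrans.naturality_apply, map_cardProj_tuple]
    rfl).symm

end Model

open Model

variable (L) in
/-- The functor from models of a Lawvere theory to models of its metric equational theory. -/
def toTheory : L.Model ⥤ TheoryModel L.theory where
  obj M := ⟨M.toSigModel, fun _ hJ => SigModel.satisfies_of_deducible
    (fun _ h => M.satisfies_axioms h) hJ⟩
  map {M N} φ := ObjectProperty.homMk (SigModel.Hom.mk (M := M.toSigModel) (N := N.toSigModel)
    (φ.hom.app L.x) fun f m =>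
      (NatTrans.naturality_apply φ.hom f.2 (tuple m)).trans
        (congrArg (N.obj.map f.2) (app_tuple φ m)))

lemma toTheory_comp_forget : L.toTheory ⋙ TheoryModel.forget L.theory = L.forget := rfl

lemma edist_toTheory_map {M N : L.Model} (φ ψ : M ⟶ N) :
    edist (L.toTheory.map φ) (L.toTheory.map ψ) = edist φ ψ := by
  change edist (φ.hom.app L.x) (ψ.hom.app L.x) = ⨆ X, edist (φ.hom.app X) (ψ.hom.app X)
  refine le_antisymm (le_iSup (fun X => edist (φ.hom.app X) (ψ.hom.app X)) L.x)
    (iSup_le fun X => Met.edist_le_iff.2 fun p => ?_)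
  obtain ⟨C, l, hl⟩ := L.exists_isPower X
  refine (N.isPower_map hl).edist_point_le fun i => ?_
  rw [← NatTrans.naturality_apply, ← NatTrans.naturality_apply]
  exact Met.edist_apply_apply_le _ _ _

instance : L.toTheory.Faithful where
  map_injective {M N φ ψ} h := eq_of_edist_eq_zero (by
    rw [← edist_toTheory_map, h, edist_self])

end LawvereTheory

namespace TheoryModel.Point

open Model

variable {M : L.Model} {X : L.Obj}

/-- The point at `X` of the model of the theory given by a point of `M(X)`. -/
def ofModel (p : M.obj.obj X) : Point (L.toTheory.obj M) X where
  eval := ⟨fun g => M.obj.map g p, .of_edist_le fun g g' => M.edist_map_apply_le g g' p⟩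
  eval_comp τ f := by
    change M.obj.map (τ ≫ f) p = M.obj.map f (tuple _)
    rw [M.obj.map_comp, comp_apply]
    congr 1
    refine (tuple_eq fun i => ?_).symm
    rw [← comp_apply, ← M.obj.map_comp]
    rfl

lemma ofModel_map {Y : L.Obj} (f : X ⟶ Y) (p : M.obj.obj X) :
    ofModel (M.obj.map f p) = (ofModel p).map f :=
  Point.ext (DFunLike.ext _ _ fun g => by
    change M.obj.map g (M.obj.map f p) = M.obj.map (f ≫ g) p
    rw [M.obj.map_comp, comp_apply])

lemma edist_ofModel (p q : M.obj.obj X) : edist (ofModel p) (ofModel q) = edist p q := by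
  apply le_antisymm
  · exact edist_le_iff.2 fun g => Met.edist_apply_le (M.obj.map g) p q
  · obtain ⟨C, l, hl⟩ := L.exists_isPower X
    exact (M.isPower_map hl).edist_point_le fun i => edist_le_iff.1 le_rfl (l i)

lemma ofModel_injective : Function.Injective (ofModel (M := M) (X := X)) := fun p q h =>
  eq_of_edist_eq_zero (by rw [← edist_ofModel, h, edist_self])

lemma exists_ofModel_eq (q : Point (L.toTheory.obj M) X) : ∃ p : M.obj.obj X, ofModel p = q := by
  obtain ⟨C, l, hl⟩ := L.exists_isPower X
  obtain ⟨p, hp⟩ := (M.isPower_map hl).exists_point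
    ⟨fun i => q.eval (l i), .of_edist_le fun i j =>
      (q.eval.edist_le _ _).trans (lipschitzWith_one_iff.1 hl.nonexp i j)⟩
  exact ⟨p, ext_of_isPower hl hp⟩

end TheoryModel.Point

namespace LawvereTheory

open TheoryModel TheoryModel.Point

instance : L.toTheory.Full where
  map_surjective {M N} φ := by
    choose ψ hψ using fun X (p : M.obj.obj X) => exists_ofModel_eq ((ofModel p).postcomp φ)
    let ψ' (X : L.Obj) : M.obj.obj X ⟶ N.obj.obj X :=
      ConcreteCategory.ofHom (C := Met) ⟨ψ X, .of_edist_le fun p q => by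
        rw [← edist_ofModel, hψ, hψ, ← edist_ofModel]
        exact edist_postcomp_le φ _ _⟩
    refine ⟨ObjectProperty.homMk ⟨ψ', fun X Y f =>
      ConcreteCategory.hom_ext _ _ fun p => ofModel_injective ?_⟩, ?_⟩
    · change ofModel (ψ Y (M.obj.map f p)) = ofModel (N.obj.map f (ψ X p))
      rw [hψ, ofModel_map, ofModel_map, hψ]
      rfl
    · refine ObjectProperty.hom_ext _ (SigModel.Hom.ext (DFunLike.ext _ _ fun p => ?_))
      have h : N.obj.map (𝟙 L.x) (ψ L.x p) = φ.hom.toNExp (M.obj.map (𝟙 L.x) p) :=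
        congrArg (fun q => q.eval (𝟙 L.x)) (hψ L.x p)
      rw [N.obj.map_id, M.obj.map_id] at h
      exact h

/-! ### From models of the theory to models of the Lawvere theory -/

/-- The functor `X ↦ Point N X`. -/
def pointFunctor (N : TheoryModel L.theory) : L.Obj ⥤ Met.{u} where
  obj X := ⟨Point N X⟩
  map h := ⟨Point.map h, .of_edist_le fun _ _ => edist_le_iff.2 fun g =>
    edist_le_iff.1 le_rfl (h ≫ g)⟩
  map_id X := NExp.ext (funext fun p : Point N X => Point.ext
    (DFunLike.ext _ _ fun g => congrArg p.eval (Category.id_comp g)))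
  map_comp {X _ _} f g := NExp.ext (funext fun p : Point N X => Point.ext
    (DFunLike.ext _ _ fun h => congrArg p.eval (Category.assoc f g h)))

variable (N : TheoryModel L.theory)

lemma isMetFunctor_pointFunctor : IsMetFunctor (pointFunctor N) := fun _ _ f g =>
  Met.edist_le_iff.2 fun p : Point N _ => Point.edist_le_iff.2 fun h =>
    (p.eval.edist_le (f ≫ h) (g ≫ h)).trans (edist_comp_right_le f g h)

lemma preservesCountablePowers_pointFunctor :
    PreservesCountablePowers.{u} (pointFunctor N) := by
  intro V _ _ X P l hl
  obtain ⟨C, l', hl'⟩ := L.exists_isPower X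
  have : Countable (WithLp 1 (V × C)) := (WithLp.equiv 1 _).injective.countable
  refine Met.isPower_of_points (.of_edist_le fun a b => (isMetFunctor_pointFunctor N _ _).trans
    (lipschitzWith_one_iff.1 hl.nonexp a b)) (fun p q r h => ?_) fun m => ?_
  · exact Point.edist_le (hl.comp hl') fun w => edist_le_iff.1 (h w.fst) (l' w.snd)
  · obtain ⟨p, hp⟩ := exists_eval (hl.comp hl') (N := N)
      ⟨fun w => (m w.fst : Point N X).eval (l' w.snd), .of_edist_le fun w w' => by
        rw [edist_withLp_one]
        refine (edist_triangle _ ((m w'.fst : Point N X).eval (l' w.snd)) _).trans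
          (add_le_add ?_ ?_)
        · exact edist_le_iff.1 (m.edist_le _ _) _
        · exact (NExp.edist_le _ _ _).trans (lipschitzWith_one_iff.1 hl'.nonexp _ _)⟩
    exact ⟨p, fun v => ext_of_isPower hl' fun i => hp (.toLp 1 (v, i))⟩

/-- The model `X ↦ Point N X` of the Lawvere theory. -/
def pointModel : L.Model :=
  ⟨pointFunctor N, isMetFunctor_pointFunctor N, preservesCountablePowers_pointFunctor N⟩

/-- Evaluation at `𝟙 x`, as a homomorphism from the model of points of `N` to `N`. -/
def evalId : L.toTheory.obj (pointModel N) ⟶ N :=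
  ObjectProperty.homMk (SigModel.Hom.mk (M := (pointModel N).toSigModel)
    ⟨fun p : Point N L.x => p.eval (𝟙 L.x), .of_edist_le fun _ _ => edist_le_iff.1 le_rfl _⟩
    fun ⟨C, f⟩ m => by
      let p : Point N (L.pow C.toCMet) := Model.tuple (M := pointModel N) m
      have hp (i : C) : p.map (L.cardProj i) = m i :=
        Model.map_cardProj_tuple (M := pointModel N) m i
      change p.eval (f ≫ 𝟙 L.x) = N.operation f _
      rw [Category.comp_id, ← Category.id_comp f, p.eval_comp, Category.id_comp]
      congr 1
      refine DFunLike.ext _ _ fun i => ?_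
      change p.eval (𝟙 _ ≫ L.cardProj i) = (m i : Point N L.x).eval (𝟙 L.x)
      rw [← hp, Category.id_comp]
      exact congrArg p.eval (Category.comp_id _).symm)

end LawvereTheory

lemma TheoryModel.isIso_of_isometry {Ω : Signature.{u}} {T : Set (Judgment Ω)}
    {M N : TheoryModel T} (φ : M ⟶ N) (h : Isometry φ.hom.toNExp)
    (h' : Function.Surjective φ.hom.toNExp) : IsIso φ := by
  choose k hk using h'
  let κ : NExp N.obj.space M.obj.space :=
    ⟨k, .of_edist_le fun x y => by rw [← h.edist_eq, hk, hk]⟩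
  let ψ : N.obj ⟶ M.obj := ⟨κ, fun f m => h.injective (by
    rw [φ.hom.map_op]
    exact (hk _).trans (congrArg (N.obj.op f) (DFunLike.ext _ _ fun i => (hk _).symm)))⟩
  exact ⟨ObjectProperty.homMk ψ,
    ObjectProperty.hom_ext _ (SigModel.Hom.ext (DFunLike.ext _ _ fun x => h.injective (hk _))),
    ObjectProperty.hom_ext _ (SigModel.Hom.ext (DFunLike.ext _ _ hk))⟩

namespace LawvereTheory

open TheoryModel TheoryModel.Point

instance (N : TheoryModel L.theory) : IsIso (evalId N) :=
  isIso_of_isometry _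
    (fun _ _ => le_antisymm (NExp.edist_le _ _ _)
      (Point.edist_le (N := N) (isPower_unit L.x) fun _ => le_rfl))
    fun n => (exists_eval (isPower_unit L.x) ⟨fun _ => n, .const' n⟩).imp fun _ hp => hp ⟨⟩

instance : L.toTheory.EssSurj where
  mem_essImage N := ⟨pointModel N, ⟨asIso (evalId N)⟩⟩

instance : L.toTheory.IsEquivalence where

variable (L) in
theorem exists_equivalence : ∃ E : L.Model ≌ TheoryModel L.theory,
    E.functor ⋙ TheoryModel.forget L.theory = L.forget ∧
    ∀ (M N : L.Model) (φ ψ : M ⟶ N), edist (E.functor.map φ) (E.functor.map ψ) = edist φ ψ :=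
  ⟨L.toTheory.asEquivalence, toTheory_comp_forget, fun _ _ => edist_toTheory_map⟩

end LawvereTheory

end Equivalence

/-! ### Countably filtered colimits of models -/

section ColimitModel

variable {Ω : Signature.{u}} {T : Set (Judgment Ω)} {J : Type u} [SmallCategory J]
  {G : J ⥤ TheoryModel T} {c : Cocone (G ⋙ TheoryModel.forget T)}

/-- A leg of a cocone under the underlying spaces of a diagram of models. -/
def coconeMap (c : Cocone (G ⋙ TheoryModel.forget T)) (j : J) :
    NExp (G.obj j).obj.space c.pt :=
  c.ι.app j

lemma coconeMap_map {j k : J} (f : j ⟶ k) (x : (G.obj j).obj.space) :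
    coconeMap c k ((G.map f).hom.toNExp x) = coconeMap c j x :=
  c.w_apply f x

lemma desc_coconeMap [IsFiltered J] (hc : IsTight c) (s : Cocone G) {j : J}
    (x : (G.obj j).obj.space) :
    hc.desc ((TheoryModel.forget T).mapCocone s) (coconeMap c j x) = (s.ι.app j).hom.toNExp x :=
  hc.desc_ι_apply ((TheoryModel.forget T).mapCocone s) x

variable [IsCardinalFiltered J (Cardinal.aleph 1 : Cardinal.{u})]

lemma exists_comp_coconeMap_eq (hc : IsTight c) {C : Type w} [EMetricSpace C] [Countable C]
    (m : NExp C c.pt) : ∃ (j : J) (x : NExp C (G.obj j).obj.space), x.comp (coconeMap c j) = m := by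
  obtain ⟨j, x, hx, h⟩ := hc.exists_isometric_lift (hasCardinalLT_aleph_one.{u} C) m
  exact ⟨j, ⟨x, .of_edist_le fun i i' => (h i i').trans (m.edist_le i i')⟩, DFunLike.ext _ _ hx⟩

lemma edist_coconeMap_op_le (hc : IsTight c) {f : Ω.Op} {j k : J}
    (x : NExp (Ω.arity f) (G.obj j).obj.space) (y : NExp (Ω.arity f) (G.obj k).obj.space) :
    edist (coconeMap c j ((G.obj j).obj.op f x)) (coconeMap c k ((G.obj k).obj.op f y)) ≤
      edist (x.comp (coconeMap c j)) (y.comp (coconeMap c k)) := by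
  obtain ⟨l, a, b, h⟩ :=
    hc.exists_forall_edist_map_map_le (hasCardinalLT_aleph_one.{u} (Ω.arity f)) x y
  rw [← coconeMap_map a, ← coconeMap_map b, (G.map a).hom.map_op, (G.map b).hom.map_op]
  calc
    _ ≤ edist (x.comp (G.map a).hom.toNExp) (y.comp (G.map b).hom.toNExp) :=
        (NExp.edist_le _ _ _).trans (NExp.edist_le _ _ _)
    _ ≤ edist (x.comp (coconeMap c j)) (y.comp (coconeMap c k)) :=
        NExp.edist_le_iff.2 fun i => (h i).trans
          (NExp.edist_apply_le (x.comp (coconeMap c j)) (y.comp (coconeMap c k)) i)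

variable (hc : IsTight c)

/-- An operation on the vertex of a tight cocone: the arguments are lifted to a common stage, which
is possible because arities are countable. -/
def colimitOp (f : Ω.Op) : NExp (NExp (Ω.arity f) c.pt) c.pt where
  toFun m := coconeMap c _ ((G.obj _).obj.op f (exists_comp_coconeMap_eq hc m).choose_spec.choose)
  nonexp := .of_edist_le fun m n => by
    refine (edist_coconeMap_op_le hc _ _).trans ?_
    rw [(exists_comp_coconeMap_eq hc m).choose_spec.choose_spec,
      (exists_comp_coconeMap_eq hc n).choose_spec.choose_spec]

lemma colimitOp_comp_coconeMap {f : Ω.Op} {j : J} (x : NExp (Ω.arity f) (G.obj j).obj.space) :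
    colimitOp hc f (x.comp (coconeMap c j)) = coconeMap c j ((G.obj j).obj.op f x) := by
  refine eq_of_edist_eq_zero (le_bot_iff.1 ((edist_coconeMap_op_le hc _ _).trans ?_))
  rw [(exists_comp_coconeMap_eq hc (x.comp (coconeMap c j))).choose_spec.choose_spec, edist_self]
  exact le_rfl

/-- The model on the vertex of a tight cocone. -/
abbrev colimitModel : SigModel Ω where
  space := c.pt
  op := colimitOp hc

lemma exists_assignment_lift {Γ : Context ℕ} (α : (colimitModel hc).Assignment Γ) :
    ∃ (j : J) (β : (G.obj j).obj.Assignment Γ), ∀ n, α.1 n = coconeMap c j (β.1 n) := by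
  obtain ⟨j, x, hx, h⟩ := hc.exists_isometric_lift (hasCardinalLT_aleph_one.{u} ℕ) α.1
  exact ⟨j, ⟨x, fun n ε n' hn => (h n n').trans (α.2 n ε n' hn)⟩, fun n => (hx n).symm⟩

lemma exists_mem_interp_colimitModel {Γ : Context ℕ} {t : Preterm Ω ℕ}
    (ht : ∀ j, (G.obj j).obj.Satisfies (.ok Γ t)) :
    ∃ w ∈ (colimitModel hc).interp Γ t, ∀ (j : J) (β : (G.obj j).obj.Assignment Γ)
      (α : (colimitModel hc).Assignment Γ), (∀ n, α.1 n = coconeMap c j (β.1 n)) →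
      ∀ v ∈ (G.obj j).obj.interp Γ t, w α = coconeMap c j (v β) := by
  induction t with
  | var n =>
    refine ⟨_, (SigModel.mem_interp_var _).2 rfl, fun j β α h v hv => ?_⟩
    rw [(SigModel.mem_interp_var _).1 hv]
    exact h n
  | op f t ih =>
    choose w hw h using fun i => ih i fun j => (ht j).fst i
    have hlip (α) : LipschitzWith 1 fun i => w i α := by
      obtain ⟨j, β, hβ⟩ := exists_assignment_lift hc α
      obtain ⟨u, hu⟩ := SigModel.satisfies_ok_iff.1 (ht j)
      obtain ⟨v, hv, hv_lip, -⟩ := (SigModel.mem_interp_op _).1 hu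
      simp only [fun i => h i j β α hβ _ (hv i)]
      exact (NExp.comp ⟨_, hv_lip β⟩ (coconeMap c j)).nonexp
    refine ⟨_, (SigModel.mem_interp_op _).2 ⟨w, hw, hlip, rfl⟩, fun j β α hβ u hu => ?_⟩
    obtain ⟨v, hv, hv_lip, rfl⟩ := (SigModel.mem_interp_op _).1 hu
    rw [← colimitOp_comp_coconeMap hc]
    congr 1
    exact DFunLike.ext _ _ fun i => h i j β α hβ _ (hv i)

lemma colimitModel_satisfies {K : Judgment Ω} (hK : K ∈ T) : (colimitModel hc).Satisfies K := by
  cases K with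
  | ok Γ t =>
    obtain ⟨w, hw, -⟩ := exists_mem_interp_colimitModel hc fun j => (G.obj j).property _ hK
    exact SigModel.satisfies_ok_iff.2 ⟨w, hw⟩
  | eq Γ s ε t =>
    have hG (j : J) := (G.obj j).property _ hK
    obtain ⟨w, hw, h⟩ := exists_mem_interp_colimitModel hc fun j => (hG j).ok_left
    obtain ⟨w', hw', h'⟩ := exists_mem_interp_colimitModel hc fun j => (hG j).ok_right
    refine (SigModel.satisfies_eq_iff_of_mem hw hw').2 fun α => ?_
    obtain ⟨j, β, hβ⟩ := exists_assignment_lift hc α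
    obtain ⟨v, hv⟩ := SigModel.satisfies_ok_iff.1 (hG j).ok_left
    obtain ⟨v', hv'⟩ := SigModel.satisfies_ok_iff.1 (hG j).ok_right
    rw [h j β α hβ v hv, h' j β α hβ v' hv']
    exact (NExp.edist_le _ _ _).trans ((SigModel.satisfies_eq_iff_of_mem hv hv').1 (hG j) β)

/-- The cocone of models over a tight cocone of their underlying spaces. -/
def colimitModelCocone : Cocone G where
  pt := ⟨colimitModel hc, fun _ => colimitModel_satisfies hc⟩
  ι :=
    { app j := ObjectProperty.homMk
        (SigModel.Hom.mk (M := (G.obj j).obj) (N := colimitModel hc) (coconeMap c j)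
          fun _ x => (colimitOp_comp_coconeMap hc x).symm)
      naturality _ _ f := ObjectProperty.hom_ext _ (SigModel.Hom.ext
        (DFunLike.ext _ _ fun x => coconeMap_map f x)) }

lemma desc_colimitOp (s : Cocone G) (f : Ω.Op) (m : NExp (Ω.arity f) c.pt) :
    hc.desc ((TheoryModel.forget T).mapCocone s) (colimitOp hc f m) =
      s.pt.obj.op f (m.comp (hc.desc ((TheoryModel.forget T).mapCocone s))) := by
  obtain ⟨j, x, rfl⟩ := exists_comp_coconeMap_eq hc m
  rw [colimitOp_comp_coconeMap, desc_coconeMap, (s.ι.app j).hom.map_op]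
  congr 1
  exact DFunLike.ext _ _ fun i => (desc_coconeMap hc s (x i)).symm

/-- The forgetful functor creates countably filtered colimits. -/
def colimitModelIsColimit : IsColimit (colimitModelCocone hc) where
  desc s := ObjectProperty.homMk (SigModel.Hom.mk (M := colimitModel hc) (N := s.pt.obj)
    (hc.desc ((TheoryModel.forget T).mapCocone s)) (desc_colimitOp hc s))
  fac s _ := ObjectProperty.hom_ext _ (SigModel.Hom.ext
    (DFunLike.ext _ _ fun x => desc_coconeMap hc s x))
  uniq s m hm := ObjectProperty.hom_ext _ (SigModel.Hom.ext
    (hc.isColimit.uniq ((TheoryModel.forget T).mapCocone s) m.hom.toNExp fun j =>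
      congrArg (fun f => f.hom.toNExp) (hm j)))

end ColimitModel

instance {Ω : Signature.{u}} (T : Set (Judgment Ω)) :
    (TheoryModel.forget T).IsCardinalAccessible (Cardinal.aleph 1 : Cardinal.{u}) where
  preservesColimitOfShape J _ _ := by
    refine ⟨fun {G} => ?_⟩
    have hc := isTight_colimCocone (G ⋙ TheoryModel.forget T)
    exact preservesColimit_of_preserves_colimit_cocone (colimitModelIsColimit hc)
      (IsTight.isColimit ⟨hc.surj, hc.dist⟩)

theorem ComesFrom.countableArity {R : Monad Met.{u}} {Ω : Signature.{u}} {T : Set (Judgment Ω)}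
    (h : ComesFrom R T) : CountableArity R.toFunctor := by
  obtain ⟨F, adj, ⟨e⟩⟩ := h
  have := adj.leftAdjoint_preservesColimits
  exact Functor.isCardinalAccessible_of_natIso
    (show F ⋙ TheoryModel.forget T ≅ R.toFunctor from (monadToFunctor Met).mapIso e) _

/-! ### Countable subspaces -/

/-- A metric cardinal as a metric space in an arbitrary universe. -/
abbrev MetricCardinal.toMet (C : MetricCardinal) : Met.{u} := ⟨ULift.{u} C⟩

/-- A nonexpansive map out of a metric cardinal as a morphism of metric spaces. -/
def NExp.toHom {C : MetricCardinal} {X : Met.{u}} (m : NExp C X) : C.toMet ⟶ X :=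
  ConcreteCategory.ofHom (C := Met) ⟨fun i => m i.down, .of_edist_le fun i j =>
    m.edist_le i.down j.down⟩

/-- The inverse of `NExp.toHom`. -/
def MetricCardinal.ofHom {C : MetricCardinal} {X : Met.{u}} (m : C.toMet ⟶ X) : NExp C X :=
  ⟨fun i => m ⟨i⟩, .of_edist_le fun i j => Met.edist_apply_le m ⟨i⟩ ⟨j⟩⟩

lemma exists_iso_metricCardinal (A : Met.{u}) [Countable A] :
    ∃ C : MetricCardinal, Nonempty (C.toMet ≅ A) := by
  obtain ⟨C, ⟨e⟩⟩ := exists_metricCardinal A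
  exact ⟨C, ⟨{
    hom := NExp.toHom ⟨e, e.isometry.lipschitz⟩
    inv := ConcreteCategory.ofHom (C := Met) ⟨fun a => ⟨e.symm a⟩, e.symm.isometry.lipschitz⟩
    hom_inv_id := ConcreteCategory.hom_ext _ _ fun i => ULift.ext _ _ (e.symm_apply_apply i.down)
    inv_hom_id := ConcreteCategory.hom_ext _ _ fun a => e.apply_symm_apply a }⟩⟩

lemma Met.hom_ext_of_metricCardinal {X Y : Met.{u}} {f g : X ⟶ Y}
    (h : ∀ (C : MetricCardinal) (m : C.toMet ⟶ X), m ≫ f = m ≫ g) : f = g := by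
  obtain ⟨C, ⟨e⟩⟩ := exists_iso_metricCardinal.{u} ⟨PUnit⟩
  refine ConcreteCategory.hom_ext _ _ fun x => ?_
  have hx : ofPoint x ≫ f = ofPoint x ≫ g := by
    rw [← cancel_epi e.hom, ← Category.assoc, h, Category.assoc]
  exact ConcreteCategory.congr_hom hx PUnit.unit

/-- The countable subspaces of a metric space. -/
abbrev CountableSubspace (X : Met.{u}) : Type u := {A : Set X // A.Countable}

instance (X : Met.{u}) :
    IsCardinalFiltered (CountableSubspace X) (Cardinal.aleph 1 : Cardinal.{u}) :=
  isCardinalFiltered_preorder _ _ fun K s hK => by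
    have : Countable K := by rwa [Cardinal.lt_aleph_one_iff, Cardinal.mk_le_aleph0_iff] at hK
    exact ⟨⟨⋃ k, (s k).1, Set.countable_iUnion fun k => (s k).2⟩,
      fun k => Set.subset_iUnion (fun k => (s k).1) k⟩

/-- The diagram of the countable subspaces of a metric space. -/
def subspaceFunctor (X : Met.{u}) : CountableSubspace X ⥤ Met.{u} where
  obj A := ⟨A.1⟩
  map f := ConcreteCategory.ofHom (C := Met)
    ⟨Set.inclusion (leOfHom f), .of_edist_le fun _ _ => le_rfl⟩

instance {X : Met.{u}} (A : CountableSubspace X) : Countable ((subspaceFunctor X).obj A) :=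
  A.2.to_subtype

/-- The inclusion of a countable subspace. -/
def subspaceIncl {X : Met.{u}} (A : CountableSubspace X) : (subspaceFunctor X).obj A ⟶ X :=
  ConcreteCategory.ofHom (C := Met) ⟨Subtype.val, .subtype_val A.1⟩

/-- The cocone that exhibits a metric space as the colimit of its countable subspaces. -/
def subspaceCocone (X : Met.{u}) : Cocone (subspaceFunctor X) where
  pt := X
  ι := { app A := subspaceIncl A }

lemma isTight_subspaceCocone (X : Met.{u}) : IsTight (subspaceCocone X) where
  surj x := ⟨⟨{x}, Set.countable_singleton x⟩, ⟨x, rfl⟩, rfl⟩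
  dist A _ _ := ⟨A, 𝟙 A, le_rfl⟩

lemma exists_comp_subspaceIncl_eq {X Y : Met.{u}} (m : Y ⟶ X) (A : CountableSubspace X)
    (hA : ∀ y, m y ∈ A.1) : ∃ m' : Y ⟶ (subspaceFunctor X).obj A, m' ≫ subspaceIncl A = m :=
  ⟨ConcreteCategory.ofHom (C := Met) ⟨fun y => ⟨m y, hA y⟩, .of_edist_le (Met.edist_apply_le m)⟩,
    rfl⟩

namespace CountableArity

variable {F : Met.{u} ⥤ Met.{u}} {X : Met.{u}}

lemma isTight (hF : CountableArity F) (X : Met.{u}) :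
    IsTight (F.mapCocone (subspaceCocone X)) := by
  have : F.IsCardinalAccessible (Cardinal.aleph 1 : Cardinal.{u}) := hF
  have := F.preservesColimitsOfShape_of_isCardinalAccessible
    (Cardinal.aleph 1 : Cardinal.{u}) (CountableSubspace X)
  exact isTight_of_isColimit (isColimitOfPreserves F (isTight_subspaceCocone X).isColimit)

lemma exists_comp_map_eq (hF : CountableArity F) {V : Met.{u}} [Countable V] (m : V ⟶ F.obj X) :
    ∃ (D : MetricCardinal) (n : D.toMet ⟶ X) (m' : V ⟶ F.obj D.toMet), m' ≫ F.map n = m := by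
  obtain ⟨A, x, hx, h⟩ :=
    (hF.isTight X).exists_isometric_lift (hasCardinalLT_aleph_one.{u} V) m
  obtain ⟨D, ⟨e⟩⟩ := exists_iso_metricCardinal ((subspaceFunctor X).obj A)
  let x' : V ⟶ F.obj ((subspaceFunctor X).obj A) := ConcreteCategory.ofHom (C := Met)
    ⟨x, .of_edist_le fun v w => (h v w).trans (Met.edist_apply_le m v w)⟩
  refine ⟨D, e.hom ≫ subspaceIncl A, x' ≫ F.map e.inv, ?_⟩
  rw [Category.assoc, ← F.map_comp, e.inv_hom_id_assoc]
  exact ConcreteCategory.hom_ext _ _ hx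

lemma exists_map_eq (hF : CountableArity F) (t : F.obj X) :
    ∃ (C : MetricCardinal) (m : C.toMet ⟶ X) (r : F.obj C.toMet), F.map m r = t := by
  obtain ⟨C, m, r, h⟩ := hF.exists_comp_map_eq (Met.ofPoint t)
  exact ⟨C, m, r PUnit.unit, ConcreteCategory.congr_hom h PUnit.unit⟩

lemma hom_ext (hF : CountableArity F) {Y : Met.{u}} {f g : F.obj X ⟶ Y}
    (h : ∀ (C : MetricCardinal) (m : C.toMet ⟶ X), F.map m ≫ f = F.map m ≫ g) : f = g := by
  refine ConcreteCategory.hom_ext _ _ fun t => ?_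
  obtain ⟨C, m, r, rfl⟩ := hF.exists_map_eq t
  exact ConcreteCategory.congr_hom (h C m) r

lemma exists_edist_map_le (hF : CountableArity F) {C D : MetricCardinal} (r : F.obj C.toMet)
    (s : F.obj D.toMet) (m : C.toMet ⟶ X) (n : D.toMet ⟶ X) :
    ∃ (E : MetricCardinal) (k : E.toMet ⟶ X) (m' : C.toMet ⟶ E.toMet) (n' : D.toMet ⟶ E.toMet),
      m' ≫ k = m ∧ n' ≫ k = n ∧
        edist (F.map m' r) (F.map n' s) ≤ edist (F.map m r) (F.map n s) := by
  obtain ⟨A, hm, hn⟩ :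
      ∃ A : CountableSubspace X, (∀ i, m i ∈ A.1) ∧ ∀ i, n i ∈ A.1 :=
    ⟨⟨Set.range m ∪ Set.range n, (Set.countable_range _).union (Set.countable_range _)⟩,
      fun i => .inl ⟨i, rfl⟩, fun i => .inr ⟨i, rfl⟩⟩
  obtain ⟨m, rfl⟩ := exists_comp_subspaceIncl_eq m A hm
  obtain ⟨n, rfl⟩ := exists_comp_subspaceIncl_eq n A hn
  obtain ⟨B, f, hf⟩ := (hF.isTight X).dist A (F.map m r) (F.map n s)
  obtain ⟨E, ⟨e⟩⟩ := exists_iso_metricCardinal ((subspaceFunctor X).obj B)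
  have hB : (subspaceFunctor X).map f ≫ subspaceIncl B = subspaceIncl A := (subspaceCocone X).w f
  refine ⟨E, e.hom ≫ subspaceIncl B, m ≫ (subspaceFunctor X).map f ≫ e.inv,
    n ≫ (subspaceFunctor X).map f ≫ e.inv, by simp [hB], by simp [hB], ?_⟩
  simp only [F.map_comp, comp_apply]
  exact (Met.edist_apply_le _ _ _).trans hf

end CountableArity

/-! ### The theory of a monad -/

section Algebra

variable {C : Type v} [Category.{w} C] {R : Monad C} {X Y : C} {A B : R.Algebra}

lemma η_map_algebra (m : X ⟶ A.A) : R.η.app X ≫ R.map m ≫ A.a = m := by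
  simp [← R.η.naturality_assoc, A.unit]

lemma map_μ_map_algebra (g : X ⟶ R.obj Y) (m : Y ⟶ A.A) :
    R.map g ≫ R.μ.app Y ≫ R.map m ≫ A.a = R.map (g ≫ R.map m ≫ A.a) ≫ A.a := by
  simp [← R.μ.naturality_assoc, A.assoc]

lemma map_algebra_hom (m : X ⟶ A.A) (φ : A ⟶ B) :
    R.map m ≫ A.a ≫ φ.f = R.map (m ≫ φ.f) ≫ B.a := by
  simp

end Algebra

section Monad

/-- The operation symbols of arity `C` of the theory of a monad `R`: the elements of `R(C)`. -/
abbrev MonadOperation (R : Monad Met.{u}) (C : MetricCardinal) : Type u := R.obj C.toMet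

variable {R : Monad Met.{u}} (hR : IsMetFunctor R.toFunctor)

/-- An algebra as a model of the signature of its monad: `r ∈ R(C)` acts on a tuple `m : C → A` by
`R(C) → R(A) → A`. -/
def algModel (A : R.Algebra) : SigModel (opSignature (MonadOperation R)) where
  space := A.A
  op f := ⟨fun m => (R.map m.toHom ≫ A.a) f.2, .of_edist_le fun m n =>
    (Met.edist_apply_apply_le _ _ f.2).trans ((edist_comp_right_le _ _ A.a).trans
      ((hR _ _).trans (Met.edist_le_iff.2 fun i => NExp.edist_apply_le m n i.down)))⟩

/-- The theory of a monad: all judgments which are valid in its algebras. -/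
def monadTheory : Set (Judgment (opSignature (MonadOperation R))) :=
  {J | ∀ A : R.Algebra, (algModel hR A).Satisfies J}

/-- The functor from algebras to models of the theory of the monad. -/
def algFunctor : R.Algebra ⥤ TheoryModel (monadTheory hR) where
  obj A := ⟨algModel hR A, fun _ hJ => hJ A⟩
  map {A B} φ := ObjectProperty.homMk (SigModel.Hom.mk (M := algModel hR A) (N := algModel hR B)
    φ.f fun f m =>
      ConcreteCategory.congr_hom (map_algebra_hom (NExp.toHom (X := A.A) m) φ) f.2)

section Action

variable {hR} (N : TheoryModel (monadTheory hR)) {C D : MetricCardinal}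

lemma edist_operation_le (r s : R.obj C.toMet) :
    edist (N.obj.operation (P := MonadOperation R) r) (N.obj.operation s) ≤ edist r s := by
  refine ennreal_le_of_forall_eq_coe fun ε hε => ?_
  refine (SigModel.satisfies_dist_iff (P := MonadOperation R) r s ε).1 (N.property _ fun A => ?_)
  exact (SigModel.satisfies_dist_iff (P := MonadOperation R) r s ε).2
    (NExp.edist_le_iff.2 fun m => (Met.edist_apply_le (R.map m.toHom ≫ A.a) r s).trans hε.le)

/-- The evaluation at a tuple in `N` of all operations of its arity. -/
def evalTuple (k : C.toMet ⟶ N.obj.space) : R.obj C.toMet ⟶ N.obj.space :=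
  ConcreteCategory.ofHom
    ⟨fun r => N.obj.operation (P := MonadOperation R) r (MetricCardinal.ofHom k),
      .of_edist_le fun r s => (NExp.edist_apply_le _ _ _).trans (edist_operation_le N r s)⟩

lemma η_evalTuple (k : C.toMet ⟶ N.obj.space) : R.η.app C.toMet ≫ evalTuple N k = k := by
  refine ConcreteCategory.hom_ext _ _ fun i => ?_
  refine (SigModel.satisfies_proj_iff (P := MonadOperation R) (R.η.app C.toMet i) i.down).1
    (N.property _ fun A => ?_) (MetricCardinal.ofHom k)
  refine (SigModel.satisfies_proj_iff (P := MonadOperation R) _ _).2 fun m => ?_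
  exact ConcreteCategory.congr_hom (η_map_algebra (NExp.toHom (X := A.A) m)) i

lemma map_μ_evalTuple (g : C.toMet ⟶ R.obj D.toMet) (k : D.toMet ⟶ N.obj.space) :
    R.map g ≫ R.μ.app D.toMet ≫ evalTuple N k = evalTuple N (g ≫ evalTuple N k) := by
  refine ConcreteCategory.hom_ext _ _ fun r => ?_
  obtain ⟨_, h⟩ := (SigModel.satisfies_comp_iff (P := MonadOperation R) r (fun i => g ⟨i⟩)
    (R.μ.app D.toMet (R.map g r))).1 <| N.property _ fun A =>
      (SigModel.satisfies_comp_iff (P := MonadOperation R) _ _ _).2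
        ⟨.of_edist_le fun i j => NExp.edist_le_iff.2 fun m =>
          Met.edist_apply_le (g ≫ R.map (NExp.toHom (X := A.A) m) ≫ A.a) ⟨i⟩ ⟨j⟩, fun m =>
          (ConcreteCategory.congr_hom (map_μ_map_algebra g (NExp.toHom (X := A.A) m)) r).symm⟩
  exact (h (MetricCardinal.ofHom k)).symm

lemma map_evalTuple (n : C.toMet ⟶ D.toMet) (k : D.toMet ⟶ N.obj.space) :
    R.map n ≫ evalTuple N k = evalTuple N (n ≫ k) := by
  have h := map_μ_evalTuple N (n ≫ R.η.app D.toMet) k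
  rwa [R.map_comp, Category.assoc, R.right_unit_assoc, Category.assoc, η_evalTuple] at h

end Action

section Extension

variable {hR} {N : TheoryModel (monadTheory hR)} {X : Met.{u}}

lemma edist_evalTuple_comp_le (hA : CountableArity R.toFunctor) (h : X ⟶ N.obj.space)
    {C D : MetricCardinal} (r : R.obj C.toMet)
    (s : R.obj D.toMet) (m : C.toMet ⟶ X) (n : D.toMet ⟶ X) :
    edist (evalTuple N (m ≫ h) r) (evalTuple N (n ≫ h) s) ≤ edist (R.map m r) (R.map n s) := by
  obtain ⟨E, k, m', n', rfl, rfl, hd⟩ := hA.exists_edist_map_le r s m n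
  rw [Category.assoc, Category.assoc, ← map_evalTuple, ← map_evalTuple, comp_apply, comp_apply]
  exact (Met.edist_apply_le _ _ _).trans hd

variable (hA : CountableArity R.toFunctor)

/-- The extension to `R(X)` of a map from `X` to a model: an element of `R(X)` comes from some
`r ∈ R(C)` along a tuple `C → X`, and is sent to the value of the operation `r`. -/
def extend (h : X ⟶ N.obj.space) : R.obj X ⟶ N.obj.space :=
  ConcreteCategory.ofHom
    ⟨fun t => evalTuple N ((hA.exists_map_eq t).choose_spec.choose ≫ h)
      (hA.exists_map_eq t).choose_spec.choose_spec.choose, .of_edist_le fun t t' => by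
        refine (edist_evalTuple_comp_le hA h _ _ _ _).trans ?_
        rw [(hA.exists_map_eq t).choose_spec.choose_spec.choose_spec,
          (hA.exists_map_eq t').choose_spec.choose_spec.choose_spec]⟩

lemma map_extend (h : X ⟶ N.obj.space) {C : MetricCardinal} (m : C.toMet ⟶ X) :
    R.map m ≫ extend hA h = evalTuple N (m ≫ h) := by
  refine ConcreteCategory.hom_ext _ _ fun r => eq_of_edist_eq_zero (le_bot_iff.1 ?_)
  refine (edist_evalTuple_comp_le hA h _ _ _ _).trans ?_
  rw [(hA.exists_map_eq (R.map m r)).choose_spec.choose_spec.choose_spec, edist_self]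
  exact le_rfl

lemma map_μ_extend (h : X ⟶ N.obj.space) {C : MetricCardinal} (m : C.toMet ⟶ R.obj X) :
    R.map m ≫ R.μ.app X ≫ extend hA h = evalTuple N (m ≫ extend hA h) := by
  obtain ⟨D, n, m, rfl⟩ := hA.exists_comp_map_eq m
  calc R.map (m ≫ R.map n) ≫ R.μ.app X ≫ extend hA h
      = R.map m ≫ R.μ.app D.toMet ≫ R.map n ≫ extend hA h := by
        rw [R.map_comp, Category.assoc, ← R.μ.naturality_assoc]
        rfl
    _ = evalTuple N (m ≫ R.map n ≫ extend hA h) := by rw [map_extend, map_μ_evalTuple]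
    _ = evalTuple N ((m ≫ R.map n) ≫ extend hA h) := by rw [Category.assoc]

lemma η_extend (h : X ⟶ N.obj.space) : R.η.app X ≫ extend hA h = h := by
  refine Met.hom_ext_of_metricCardinal fun C m => ?_
  have hη : m ≫ R.η.app X = R.η.app C.toMet ≫ R.map m := R.η.naturality m
  rw [← Category.assoc, hη, Category.assoc, map_extend, η_evalTuple]

/-- The extension of a map to a model, as a homomorphism from the free algebra. -/
def extendModelHom (h : X ⟶ N.obj.space) : (algFunctor hR).obj (R.free.obj X) ⟶ N :=
  ObjectProperty.homMk (SigModel.Hom.mk (M := algModel hR (R.free.obj X)) (N := N.obj)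
    (extend hA h) fun f m => ConcreteCategory.congr_hom
      (map_μ_extend hA h (NExp.toHom (X := R.obj X) m)) f.2)

/-- The map of metric spaces underlying a homomorphism from a free algebra. -/
def freeModelMap (φ : (algFunctor hR).obj (R.free.obj X) ⟶ N) : R.obj X ⟶ N.obj.space :=
  φ.hom.toNExp

lemma map_freeModelMap (φ : (algFunctor hR).obj (R.free.obj X) ⟶ N) {C : MetricCardinal}
    (m : C.toMet ⟶ X) :
    R.map m ≫ freeModelMap φ = evalTuple N (m ≫ R.η.app X ≫ freeModelMap φ) := by
  refine ConcreteCategory.hom_ext _ _ fun r => ?_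
  have h : R.map (m ≫ R.η.app X) ≫ R.μ.app X = R.map m := by
    rw [R.map_comp, Category.assoc, R.right_unit]
    exact Category.comp_id _
  calc freeModelMap φ (R.map m r)
      = freeModelMap φ ((R.map (m ≫ R.η.app X) ≫ R.μ.app X) r) := by rw [h]
    _ = evalTuple N (m ≫ R.η.app X ≫ freeModelMap φ) r :=
        φ.hom.map_op ⟨C, r⟩ (MetricCardinal.ofHom (m ≫ R.η.app X))

lemma freeModel_hom_ext (hA : CountableArity R.toFunctor)
    {φ ψ : (algFunctor hR).obj (R.free.obj X) ⟶ N}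
    (h : R.η.app X ≫ freeModelMap φ = R.η.app X ≫ freeModelMap ψ) : φ = ψ := by
  have hmap : freeModelMap φ = freeModelMap ψ :=
    hA.hom_ext fun C m => by rw [map_freeModelMap φ, map_freeModelMap ψ, h]
  exact ObjectProperty.hom_ext _ (SigModel.Hom.ext hmap)

end Extension

variable (hA : CountableArity R.toFunctor)

/-- The adjunction of the free algebras and the underlying spaces of models. -/
def freeModelAdj : R.free ⋙ algFunctor hR ⊣ TheoryModel.forget (monadTheory hR) where
  unit :=
    { app X := R.η.app X
      naturality _ _ f := R.η.naturality f }
  counit :=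
    { app N := extendModelHom hA (𝟙 N.obj.space)
      naturality N N' φ := freeModel_hom_ext hA (by
        let f : N.obj.space ⟶ N'.obj.space := φ.hom.toNExp
        change R.η.app _ ≫ R.map f ≫ extend hA (𝟙 N'.obj.space) =
          R.η.app _ ≫ extend hA (𝟙 N.obj.space) ≫ f
        rw [← R.η.naturality_assoc, η_extend, ← Category.assoc, η_extend]
        rfl) }
  left_triangle_components X := freeModel_hom_ext hA (by
    let ε : R.obj (R.obj X) ⟶ R.obj X :=
      extend (N := (algFunctor hR).obj (R.free.obj X)) hA (𝟙 (R.obj X))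
    have hε : R.η.app (R.obj X) ≫ ε = 𝟙 (R.obj X) := η_extend hA _
    change R.η.app X ≫ R.map (R.η.app X) ≫ ε = R.η.app X
    rw [← R.η.naturality_assoc, hε]
    rfl)
  right_triangle_components N := η_extend hA (𝟙 N.obj.space)

lemma freeModelAdj_μ_app (X : Met.{u}) :
    (freeModelAdj hR hA).toMonad.μ.app X = R.μ.app X := by
  let μ : R.free.obj (R.obj X) ⟶ R.free.obj X := { f := R.μ.app X, h := R.assoc X }
  have h : extendModelHom (N := (algFunctor hR).obj (R.free.obj X)) hA (𝟙 (R.obj X)) =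
      (algFunctor hR).map μ :=
    freeModel_hom_ext hA ((η_extend hA _).trans (R.left_unit X).symm)
  exact congrArg freeModelMap h

/-- The monad of the free models is the given monad. -/
def freeModelMonadIso : (freeModelAdj hR hA).toMonad ≅ R :=
  MonadIso.mk (NatIso.ofComponents (fun X => Iso.refl (R.obj X)) fun f =>
      (Category.comp_id (R.map f)).trans (Category.id_comp (R.map f)).symm)
    (fun X => Category.comp_id (R.η.app X))
    fun X => by
      refine (Category.comp_id ((freeModelAdj hR hA).toMonad.μ.app X)).trans ?_
      rw [freeModelAdj_μ_app]
      have h : R.map (𝟙 (R.obj X)) ≫ 𝟙 (R.obj (R.obj X)) = 𝟙 _ := by simp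
      exact (congrArg (· ≫ R.μ.app X) h).symm

theorem exists_isMET_comesFrom (hR : IsMetFunctor R.toFunctor) (hA : CountableArity R.toFunctor) :
    ∃ (Ω : Signature.{u}) (T : Set (Judgment Ω)), IsMET T ∧ ComesFrom R T :=
  ⟨_, monadTheory hR, isMET_of_models _, _, freeModelAdj hR hA, ⟨freeModelMonadIso hR hA⟩⟩

end Monad

end MetEq

end

theorem mainTheorem2 :
    (∀ L : MetEq.LawvereTheory.{u},
      MetEq.IsMET L.theory ∧
      ∃ E : L.Model ≌ MetEq.TheoryModel L.theory,
        E.functor ⋙ MetEq.TheoryModel.forget L.theory = L.forget ∧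
        ∀ (M N : L.Model) (φ ψ : M ⟶ N), edist (E.functor.map φ) (E.functor.map ψ) = edist φ ψ) ∧
    (∀ R : Monad MetEq.Met.{u}, MetEq.IsMetFunctor R.toFunctor →
      ((∃ (Ω : MetEq.Signature.{u}) (T : Set (MetEq.Judgment Ω)),
          MetEq.IsMET T ∧ MetEq.ComesFrom R T) ↔
        MetEq.CountableArity R.toFunctor)) :=
  ⟨fun L => ⟨L.isMET_theory, L.exists_equivalence⟩, fun _ hR =>
    ⟨fun ⟨_, _, _, h⟩ => h.countableArity, fun hA => MetEq.exists_isMET_comesFrom hR hA⟩⟩
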